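/- **Setting.** Let $G$ be a finite simple graph with $n$ vertices and $m$ edges. Each of $k$ players places a facility on a vertex $u_1,\dots,u_k$, the vertices being distinct. For a vertex $v$ let $C_v$ be the set of players $i$ with $\mathrm{dist}(v,u_i)\le \mathrm{dist}(v,u_j)$ for all $j\ne i$ (the distance is $\infty$ between different components), and let the score of player $i$ be $\sum_{v:\, i\in C_v} 1/|C_v|$. The graph $G$ is $z$-balanced for $k$ players if for every placement every score lies in $[\lfloor n/k\rfloor - z,\ \lceil n/k\rceil + z]$. Let $N_i(v)$ be the set of vertices at distance at most $i$ from $v$, and let $r=\min_v\max_u \mathrm{dist}(u,v)$ be the radius of $G$. $G_{n,d}$ is the random graph on $n$ vertices in which every edge is present independently with probability $d/(n-1)$. **Theorem (graph traversal algorithm).** There are an absolute constant $c_2>0$ and a single deterministic algorithm $A$ (a program of a unit-cost random access machine with addition, truncated subtraction and comparison) whose input is a graph $G$ given by adjacency lists, a number of players $k$, and the integer bound $\lfloor \delta n\rfloor$, with the following properties. 1. On every input $A$ halts within $O(n(m+n)+1)$ steps, with an absolute implied constant. 2. $A$ is a certificate of balancedness: for every $G$, $k$ and real $\delta\ge 0$,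 if $A$ accepts $(G,k,\lfloor\delta n\rfloor)$ then $G$ is $\delta n$-balanced for $k$ players. 3. $A$ accepts in particular whenever $r$ is finite, every vertex reaches all $n$ vertices within $r$ hops ($|N_r(v)|=n$ for all $v$), and every vertex reaches at most $\delta n/k$ vertices within $r-1$ hops ($|N_{r-1}(v)|\le \delta n/k$ for all $v$, where $N_{r-1}(v)$ is read as $N_0(v)=\{v\}$ if $r=0$). 4. Let $d=d(n)\le n-1$ be such that $d\ge C\ln n$ for some constant $C>1$ and all large $n$, and such that $d$ is not of the form $n^{1/i}$ for a positive integer $i$, in the asymptotic sense that for every constant $M>0$ and all sufficiently large $n$ there is no integer $i\ge 1$ with $n\le M d^i$ and $d^i\le M n$. (For example $d=n^{\varepsilon}$ with a constant $0<\varepsilon<1$, $\varepsilon\ne 1/i$ for all $i$; or $d=\omega(n^{1/i})$ and $d=o(n^{1/(i-1)})$ for some fixed $i\ge 2$.) Let $k=c_1d$, rounded to an integer in either direction, for a constant $c_1>0$. Then for every constant $\delta\ge c_1c_2$, on $G\sim G_{n,d}$ the algorithm $A$ accepts $(G,k,\lfloor\delta n\rfloor)$ with probability tending to $1$ as $n\to\infty$.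 -/

import Mathlib

open Filter Topology

namespace FacilityGame

section Game

variable {V : Type*} [Fintype V]

/-- `iterNbhd G i v` is the `i`-th neighborhood `N_i(v)`: `N_0(v) = {v}` and
`N_{i+1}(v) = N(N_i(v))`, where `N(S)` consists of `S` and of all neighbors of elements of `S`. -/
def iterNbhd (G : SimpleGraph V) : ℕ → V → Set V
  | 0, v => {v}
  | i + 1, v => {w | ∃ s ∈ iterNbhd G i v, w = s ∨ G.Adj s w}

open scoped Classical in
/-- The set `C_v` of the players whose facility is closest to `v`, for the placement `u`.
Distances are in `ℕ∞`, with value `⊤` between different components. -/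
noncomputable def closestPlayers (G : SimpleGraph V) {k : ℕ} (u : Fin k → V) (v : V) :
    Finset (Fin k) :=
  {i | ∀ j, j ≠ i → G.edist v (u i) ≤ G.edist v (u j)}

open scoped Classical in
/-- The score of player `i`: every vertex `v` with `i ∈ C_v` contributes `1 / |C_v|`. -/
noncomputable def score (G : SimpleGraph V) {k : ℕ} (u : Fin k → V) (i : Fin k) : ℝ :=
  ∑ v : V, if i ∈ closestPlayers G u v then ((closestPlayers G u v).card : ℝ)⁻¹ else 0

/-- `G` is `z`-balanced for `k` players: in every placement of the `k` facilities on distinct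
vertices, every score lies between `⌊n/k⌋ - z` and `⌈n/k⌉ + z`. -/
def IsBalanced (G : SimpleGraph V) (k : ℕ) (z : ℝ) : Prop :=
  ∀ u : Fin k → V, Function.Injective u → ∀ i : Fin k,
    (⌊(Fintype.card V : ℝ) / k⌋ : ℝ) - z ≤ score G u i ∧
      score G u i ≤ (⌈(Fintype.card V : ℝ) / k⌉ : ℝ) + z

/-- The two conditions on the neighborhood sizes, `r` being the (finite) radius of `G`:
`|N_r(v)| = n` and `|N_{r-1}(v)| ≤ z / k` for every vertex `v`. -/
def TraversalConditions (G : SimpleGraph V) (k : ℕ) (z : ℝ) : Prop :=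
  ∃ r : ℕ, G.radius = r ∧
    (∀ v, (iterNbhd G r v).ncard = Fintype.card V) ∧
    (∀ v, ((iterNbhd G (r - 1) v).ncard : ℝ) ≤ z / k)

end Game

section Random

/-- The Erdős–Rényi distribution `G_{n,d}`: each edge is present independently with probability
`d / (n - 1)` (projected to `[0, 1]`, which changes nothing when `0 ≤ d ≤ n - 1`). -/
noncomputable def randomGraph (n : ℕ) (d : ℝ) : MeasureTheory.Measure (SimpleGraph (Fin n)) :=
  SimpleGraph.binomialRandom (Fin n) (Set.projIcc (0 : ℝ) 1 zero_le_one (d / ((n : ℝ) - 1)))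

end Random

/-! ### A unit-cost random access machine, programmed in structured form

A program uses variables and arrays of natural numbers (only those that it names, hence finitely
many of each). The arithmetic operations are addition, truncated subtraction and comparison; every
operation, memory access, assignment and test costs one step. -/

/-- Expressions: constants, variables, array entries, sums, truncated differences, and comparisons
(with value `1` for true and `0` for false). -/
inductive Expr : Type
  | const (c : ℕ)
  | var (x : ℕ)
  | get (a : ℕ) (i : Expr)
  | add (e f : Expr)
  | sub (e f : Expr)
  | le (e f : Expr)

/-- Programs. Tests count as true when the expression is nonzero. -/
inductive Prog : Type
  | skip
  | assign (x : ℕ) (e : Expr)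
  | store (a : ℕ) (i e : Expr)
  | seq (P Q : Prog)
  | ite (b : Expr) (P Q : Prog)
  | loop (b : Expr) (P : Prog)

/-- A memory state: the values of the variables and the contents of the arrays. -/
structure State : Type where
  var : ℕ → ℕ
  arr : ℕ → ℕ → ℕ

/-- The value of an expression in a state. -/
def Expr.eval (s : State) : Expr → ℕ
  | .const c => c
  | .var x => s.var x
  | .get a i => s.arr a (i.eval s)
  | .add e f => e.eval s + f.eval s
  | .sub e f => e.eval s - f.eval s
  | .le e f => if e.eval s ≤ f.eval s then 1 else 0

/-- The number of steps needed to evaluate an expression: its number of operations and operands. -/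
def Expr.cost : Expr → ℕ
  | .const _ => 1
  | .var _ => 1
  | .get _ i => i.cost + 1
  | .add e f => e.cost + f.cost + 1
  | .sub e f => e.cost + f.cost + 1
  | .le e f => e.cost + f.cost + 1

/-- Write `c` into the variable `x`. -/
def State.setVar (s : State) (x c : ℕ) : State :=
  { s with var := Function.update s.var x c }

/-- Write `c` into entry `i` of the array `a`. -/
def State.setArr (s : State) (a i c : ℕ) : State :=
  { s with arr := Function.update s.arr a (Function.update (s.arr a) i c) }

/-- `Exec P s s' t`: started in the state `s`, the program `P` halts in the state `s'` after
exactly `t` steps. -/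
inductive Exec : Prog → State → State → ℕ → Prop
  | skip (s : State) : Exec .skip s s 1
  | assign (s : State) (x : ℕ) (e : Expr) :
      Exec (.assign x e) s (s.setVar x (e.eval s)) (e.cost + 1)
  | store (s : State) (a : ℕ) (i e : Expr) :
      Exec (.store a i e) s (s.setArr a (i.eval s) (e.eval s)) (i.cost + e.cost + 1)
  | seq {P Q : Prog} {s s' s'' : State} {t t' : ℕ} :
      Exec P s s' t → Exec Q s' s'' t' → Exec (.seq P Q) s s'' (t + t')
  | iteTrue {b : Expr} {P Q : Prog} {s s' : State} {t : ℕ} :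
      b.eval s ≠ 0 → Exec P s s' t → Exec (.ite b P Q) s s' (b.cost + 1 + t)
  | iteFalse {b : Expr} {P Q : Prog} {s s' : State} {t : ℕ} :
      b.eval s = 0 → Exec Q s s' t → Exec (.ite b P Q) s s' (b.cost + 1 + t)
  | loopDone {b : Expr} {P : Prog} {s : State} :
      b.eval s = 0 → Exec (.loop b P) s s (b.cost + 1)
  | loopStep {b : Expr} {P : Prog} {s s' s'' : State} {t t' : ℕ} :
      b.eval s ≠ 0 → Exec P s s' t → Exec (.loop b P) s' s'' t' →
      Exec (.loop b P) s s'' (b.cost + 1 + t + t')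

/-- Execution is deterministic, so the result and the running time are well defined. -/
theorem Exec.unique {P : Prog} {s s₁ s₂ : State} {t₁ t₂ : ℕ}
    (h₁ : Exec P s s₁ t₁) (h₂ : Exec P s s₂ t₂) : s₁ = s₂ ∧ t₁ = t₂ := by
  induction h₁ generalizing s₂ t₂ with
  | skip s => cases h₂; exact ⟨rfl, rfl⟩
  | assign s x e => cases h₂; exact ⟨rfl, rfl⟩
  | store s a i e => cases h₂; exact ⟨rfl, rfl⟩
  | seq _ _ ih ih' =>
    cases h₂ with
    | seq g g' =>
      obtain ⟨rfl, rfl⟩ := ih g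
      obtain ⟨rfl, rfl⟩ := ih' g'
      exact ⟨rfl, rfl⟩
  | iteTrue hb _ ih =>
    cases h₂ with
    | iteTrue _ g => obtain ⟨rfl, rfl⟩ := ih g; exact ⟨rfl, rfl⟩
    | iteFalse hb' _ => exact absurd hb' hb
  | iteFalse hb _ ih =>
    cases h₂ with
    | iteTrue hb' _ => exact absurd hb hb'
    | iteFalse _ g => obtain ⟨rfl, rfl⟩ := ih g; exact ⟨rfl, rfl⟩
  | loopDone hb =>
    cases h₂ with
    | loopDone _ => exact ⟨rfl, rfl⟩
    | loopStep hb' _ _ => exact absurd hb hb'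
  | loopStep hb _ _ ih ih' =>
    cases h₂ with
    | loopDone hb' => exact absurd hb' hb
    | loopStep _ g g' =>
      obtain ⟨rfl, rfl⟩ := ih g
      obtain ⟨rfl, rfl⟩ := ih' g'
      exact ⟨rfl, rfl⟩

/-- The program halts on `s` within `T` steps. -/
def Prog.HaltsWithin (P : Prog) (s : State) (T : ℕ) : Prop :=
  ∃ s' t, Exec P s s' t ∧ t ≤ T

/-- The program accepts `s`: it halts with the value `1` in variable `0`. -/
def Prog.Accepts (P : Prog) (s : State) : Prop :=
  ∃ s' t, Exec P s s' t ∧ s'.var 0 = 1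

open scoped Classical in
/-- The neighbors of `v` in increasing order. -/
noncomputable def adjList {n : ℕ} (G : SimpleGraph (Fin n)) (v : Fin n) : List ℕ :=
  ((List.finRange n).filter fun w => G.Adj v w).map fun w => (w : ℕ)

/-- The concatenation of the adjacency lists of the vertices `0, …, j - 1`. -/
noncomputable def adjConcat {n : ℕ} (G : SimpleGraph (Fin n)) (j : ℕ) : List ℕ :=
  ((List.finRange n).take j).flatMap (adjList G)

/-- The input state for a graph `G` on `n` vertices and two numbers `k` and `z`: the variables
`1`, `2`, `3` hold `n`, `k`, `z`; the array `1` holds the concatenation of all adjacency lists, and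
entry `v ≤ n` of the array `0` holds the position in it at which the list of `v` starts. All other
memory is zero. -/
noncomputable def inputState {n : ℕ} (G : SimpleGraph (Fin n)) (k z : ℕ) : State where
  var x := if x = 1 then n else if x = 2 then k else if x = 3 then z else 0
  arr a j :=
    if a = 0 then (if j ≤ n then (adjConcat G j).length else 0)
    else if a = 1 then (adjConcat G n).getD j 0
    else 0

end FacilityGame

namespace FacilityGame

/-! ### A threshold radius forces balancedness. -/

section Certificate

variable {V : Type*}

/-! Call ρ a threshold radius for h if every ball of radius ρ has at most h vertices and every ball
of radius ρ + 1 misses at most h vertices (`HasThreshold`). A vertex that is within ρ of no facility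
and within ρ + 1 of all of them is at distance exactly ρ + 1 from each, and so gives 1/k to every
player. Summing the deviations over the remaining vertices shows that every score is within 2h of
n/k (`HasThreshold.isBalanced`).

The algorithm tests for a threshold radius with h = min n ⌊z/2⌋, where z = ⌊δn⌋, after accepting at
once if k ≤ 1 or h = n. Breadth-first search from v orders the vertices by distance, so the level at
queue position h tells from which radius on the ball around v exceeds h, and the level at position n
- h - 1 from which radius on it misses at most h (`BfsInv.levelSpec`). A minimum and a maximum of
these levels over all v decide the question exactly (`RadiusBounds.hasThreshold_iff`), with n
searches of cost O(m + n). For k ≥ 2 the neighborhood conditions make r - 1 a threshold radius,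
because δn/k ≤ δn/2.

On the random graph the gap hypothesis puts n well between consecutive powers d^(L+1) and d^(L+2),
and ρ = L + 1 is a threshold radius. The search from v is a branching-like exploration: given the
balls so far, the next layer is determined by fresh edges (`integral_exploration_step`). This yields
recursions for exponential moments. Upward they show that balls of radius j have at most 9(np+1)^j
vertices; downward, that layer L + 1 has at least a constant times (d-1)^(L+1) vertices. A vertex
outside the ball then misses that layer with small probability, so few vertices remain beyond radius
L + 2 (`measureReal_missing_le`). The dominant failure probability at one vertex is
exp(-(d-1)(1-3ε)), and C > 1 leaves room for a union bound over all n vertices. -/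

theorem mem_iterNbhd_iff (G : SimpleGraph V) (i : ℕ) (v w : V) :
    w ∈ iterNbhd G i v ↔ G.edist v w ≤ i := by
  induction i generalizing w with
  | zero => simp [iterNbhd, eq_comm (a := w)]
  | succ i ih =>
    simp only [iterNbhd, Set.mem_ofPred_eq]
    constructor
    · rintro ⟨s, hs, rfl | hsw⟩
      · exact ((ih _).1 hs).trans (by exact_mod_cast Nat.le_succ i)
      · refine (G.edist_triangle (v := s)).trans ?_
        rw [SimpleGraph.edist_eq_one_iff_adj.2 hsw]
        push_cast
        gcongr
        exact (ih _).1 hs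
    · intro h
      obtain ⟨p, hp⟩ := G.exists_walk_of_edist_ne_top (ne_top_of_le_ne_top (ENat.natCast_ne_top _) h)
      by_cases hnil : p.Nil
      · obtain rfl := hnil.eq
        exact ⟨v, (ih _).2 (by simp), Or.inl rfl⟩
      · refine ⟨p.penultimate, (ih _).2 ?_, Or.inr (p.adj_penultimate hnil)⟩
        refine (SimpleGraph.edist_le p.dropLast).trans ?_
        rw [← hp] at h
        have h' : p.length ≤ i + 1 := by exact_mod_cast h
        have : p.dropLast.length ≤ i := by
          have := p.length_dropLast_add_one hnil
          omega
        exact_mod_cast this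

/-- All balls of radius `ρ` have at most `h` vertices, and all balls of radius `ρ + 1` miss at
most `h` vertices. -/
def HasThreshold [Fintype V] (G : SimpleGraph V) (h : ℕ) : Prop :=
  ∃ ρ : ℕ, ∀ v, (iterNbhd G ρ v).ncard ≤ h ∧ Fintype.card V ≤ (iterNbhd G (ρ + 1) v).ncard + h

open scoped Classical in
theorem card_filter_edist_le [Fintype V] (G : SimpleGraph V) (ρ : ℕ) (x : V) :
    (Finset.univ.filter fun v => G.edist v x ≤ ρ).card = (iterNbhd G ρ x).ncard := by
  rw [← Set.ncard_coe_finset]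
  congr 1
  ext v
  simp [mem_iterNbhd_iff, SimpleGraph.edist_comm]

theorem isBalanced_of_le_one [Fintype V] (G : SimpleGraph V) {k : ℕ} (hk : k ≤ 1) {z : ℝ} (hz : 0 ≤ z) :
    IsBalanced G k z := by
  intro u _ i
  have hk1 : k = 1 := by have := i.2; omega
  subst hk1
  have hC : ∀ v, closestPlayers G u v = {i} := by
    intro v
    refine Finset.eq_singleton_iff_unique_mem.2 ⟨?_, fun _ _ => Subsingleton.elim _ _⟩
    exact Finset.mem_filter.2
      ⟨Finset.mem_univ _, fun a ha => absurd (Subsingleton.elim a i) ha⟩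
  have : score G u i = (Fintype.card V : ℝ) := by
    simp [score, hC]
  rw [this]
  simp [hz]

open scoped Classical in
-- If u i is at distance exactly ρ + 1 from v and is closest, then all s players within ρ + 1 tie,
-- and 1/s ≤ (1 + k - s)/k because (s - 1)(k - s) ≥ 0. If even the closest player is beyond ρ + 1,
-- the last term alone is 1.
theorem contribution_le (G : SimpleGraph V) {k : ℕ} (u : Fin k → V) (i : Fin k) (ρ : ℕ) (v : V) :
    (if i ∈ closestPlayers G u v then ((closestPlayers G u v).card : ℝ)⁻¹ else 0) ≤
      1 / k + (if G.edist v (u i) ≤ ρ then 1 else 0) +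
        (∑ j, if G.edist v (u j) ≤ (ρ + 1 : ℕ) then 0 else 1 : ℝ) / k := by
  have hk : (0 : ℝ) < k := by exact_mod_cast i.pos
  have hs : (0 : ℝ) ≤ ∑ j, if G.edist v (u j) ≤ (ρ + 1 : ℕ) then 0 else 1 :=
    Finset.sum_nonneg fun j _ => by split_ifs <;> norm_num
  have hs' := div_nonneg hs hk.le
  have hk' : 0 ≤ 1 / (k : ℝ) := by positivity
  by_cases hi : i ∈ closestPlayers G u v
  swap
  · rw [if_neg hi]
    have : (0 : ℝ) ≤ if G.edist v (u i) ≤ ρ then 1 else 0 := by split_ifs <;> norm_num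
    linarith
  rw [if_pos hi]
  have hcard : 1 ≤ (closestPlayers G u v).card := Finset.card_pos.2 ⟨i, hi⟩
  have hinv : ((closestPlayers G u v).card : ℝ)⁻¹ ≤ 1 :=
    inv_le_one_of_one_le₀ (by exact_mod_cast hcard)
  by_cases hnear : G.edist v (u i) ≤ ρ
  · rw [if_pos hnear]; linarith
  rw [if_neg hnear]
  have hmin : ∀ j, G.edist v (u i) ≤ G.edist v (u j) := by
    intro j
    by_cases hj : j = i
    · rw [hj]
    · exact (Finset.mem_filter.1 hi).2 j hj
  have hsum : (∑ j, if G.edist v (u j) ≤ (ρ + 1 : ℕ) then 0 else 1 : ℝ) =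
      k - (Finset.univ.filter fun j => G.edist v (u j) ≤ (ρ + 1 : ℕ)).card := by
    rw [Finset.card_eq_sum_ones, Finset.sum_filter]
    have : (k : ℝ) = ∑ _j : Fin k, (1 : ℝ) := by simp
    rw [this]
    push_cast
    rw [← Finset.sum_sub_distrib]
    refine Finset.sum_congr rfl fun j _ => ?_
    split_ifs <;> norm_num
  rw [hsum]
  by_cases hmid : G.edist v (u i) ≤ (ρ + 1 : ℕ)
  · set S := Finset.univ.filter fun j => G.edist v (u j) ≤ (ρ + 1 : ℕ)
    have hsub : S ⊆ closestPlayers G u v := by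
      intro j hj
      have hj := (Finset.mem_filter.1 hj).2
      refine Finset.mem_filter.2 ⟨Finset.mem_univ _, fun l _ => ?_⟩
      refine hj.trans (le_trans ?_ (hmin l))
      push_cast
      exact Order.add_one_le_of_lt (not_le.1 hnear)
    have hSpos : 1 ≤ S.card := Finset.card_pos.2 ⟨i, by simpa [S] using hmid⟩
    have h1 : ((closestPlayers G u v).card : ℝ)⁻¹ ≤ (S.card : ℝ)⁻¹ := by
      have : (1 : ℝ) ≤ S.card := by exact_mod_cast hSpos
      exact inv_anti₀ (by linarith) (by exact_mod_cast Finset.card_le_card hsub)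
    have hSk : (S.card : ℝ) ≤ k := by
      have := Finset.card_le_univ S
      rw [Fintype.card_fin] at this
      exact_mod_cast this
    have hS1 : (1 : ℝ) ≤ S.card := by exact_mod_cast hSpos
    refine h1.trans ?_
    rw [add_zero, ← add_div, inv_eq_one_div, div_le_div_iff₀ (by linarith) hk]
    nlinarith
  · have : (Finset.univ.filter fun j => G.edist v (u j) ≤ (ρ + 1 : ℕ)) = ∅ := by
      rw [Finset.filter_eq_empty_iff]
      intro j _ hj
      exact hmid ((hmin j).trans hj)
    rw [this]
    simp only [Finset.card_empty, Nat.cast_zero, sub_zero, div_self hk.ne']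
    linarith

open scoped Classical in
-- The left side is positive only if u i is within ρ + 1 of v and nobody is within ρ; then i is
-- closest and shares v with at most k players.
theorem le_contribution (G : SimpleGraph V) {k : ℕ} (u : Fin k → V) (i : Fin k) (ρ : ℕ) (v : V) :
    1 / k - (if G.edist v (u i) ≤ (ρ + 1 : ℕ) then 0 else 1) / k -
        (∑ j, if G.edist v (u j) ≤ ρ then 1 else 0 : ℝ) / k ≤
      if i ∈ closestPlayers G u v then ((closestPlayers G u v).card : ℝ)⁻¹ else 0 := by
  have hk : (0 : ℝ) < k := by exact_mod_cast i.pos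
  have h0 : (0 : ℝ) ≤ if i ∈ closestPlayers G u v then ((closestPlayers G u v).card : ℝ)⁻¹
      else 0 := by split_ifs <;> positivity
  have hn : ∀ j, (0 : ℝ) ≤ if G.edist v (u j) ≤ ρ then 1 else 0 := fun j => by
    split_ifs <;> norm_num
  have hs := Finset.sum_nonneg fun j (_ : j ∈ Finset.univ) => hn j
  by_cases hmid : G.edist v (u i) ≤ (ρ + 1 : ℕ)
  swap
  · rw [if_neg hmid]
    have := div_nonneg hs hk.le
    linarith
  rw [if_pos hmid]
  by_cases hnear : ∃ j, G.edist v (u j) ≤ ρ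
  · obtain ⟨j, hj⟩ := hnear
    have : (1 : ℝ) ≤ ∑ j, if G.edist v (u j) ≤ ρ then 1 else 0 := by
      refine le_trans ?_ (Finset.single_le_sum (fun j _ => hn j) (Finset.mem_univ j))
      rw [if_pos hj]
    have := div_le_div_of_nonneg_right this hk.le
    rw [zero_div, sub_zero]
    linarith
  · push Not at hnear
    have hi : i ∈ closestPlayers G u v := by
      refine Finset.mem_filter.2 ⟨Finset.mem_univ _, fun j _ => hmid.trans ?_⟩
      push_cast
      exact Order.add_one_le_of_lt (hnear j)
    rw [if_pos hi, Finset.sum_eq_zero fun j _ => if_neg (not_le.2 (hnear j))]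
    have hcard : 1 ≤ (closestPlayers G u v).card := Finset.card_pos.2 ⟨i, hi⟩
    have hle := Finset.card_le_univ (closestPlayers G u v)
    rw [Fintype.card_fin] at hle
    rw [zero_div, sub_zero, sub_zero, one_div]
    exact inv_anti₀ (by exact_mod_cast hcard) (by exact_mod_cast hle)

/-- Double counting: the pairs of a player and a near vertex number at most kh, and so do the pairs
with a far vertex. Hence the score is at most n/k + h + h and at least n/k - h/k - h. -/
theorem HasThreshold.isBalanced [Fintype V] {G : SimpleGraph V} {h : ℕ} (hG : HasThreshold G h) (k : ℕ)
    {z : ℝ} (hz : 2 * (h : ℝ) ≤ z) : IsBalanced G k z := by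
  classical
  obtain ⟨ρ, hρ⟩ := hG
  intro u _ i
  have hk : (0 : ℝ) < k := by exact_mod_cast i.pos
  have hk1 : (1 : ℝ) ≤ k := by exact_mod_cast i.pos
  have near : ∀ j, (∑ v, if G.edist v (u j) ≤ ρ then 1 else 0 : ℝ) ≤ h := by
    intro j
    rw [Finset.sum_boole, card_filter_edist_le]
    exact_mod_cast (hρ (u j)).1
  have far : ∀ j, (∑ v, if G.edist v (u j) ≤ (ρ + 1 : ℕ) then 0 else 1 : ℝ) ≤ h := by
    intro j
    have h1 : (∑ v, if G.edist v (u j) ≤ (ρ + 1 : ℕ) then 0 else 1 : ℝ) +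
        (∑ v, if G.edist v (u j) ≤ (ρ + 1 : ℕ) then 1 else 0 : ℝ) = Fintype.card V := by
      rw [← Finset.sum_add_distrib, Finset.sum_congr rfl (g := fun _ => (1 : ℝ))]
      · simp
      · intro v _; split_ifs <;> norm_num
    rw [Finset.sum_boole, card_filter_edist_le] at h1
    have h2 : (Fintype.card V : ℝ) ≤ (iterNbhd G (ρ + 1) (u j)).ncard + h := by
      exact_mod_cast (hρ (u j)).2
    linarith
  constructor
  · have hlow := Finset.sum_le_sum fun v (_ : v ∈ Finset.univ) => le_contribution G u i ρ v
    rw [Finset.sum_sub_distrib, Finset.sum_sub_distrib, ← Finset.sum_div, ← Finset.sum_div,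
      ← Finset.sum_div, Finset.sum_comm, Finset.sum_const, nsmul_eq_mul, Finset.card_univ,
      mul_one] at hlow
    have h1 : (∑ j, ∑ v, if G.edist v (u j) ≤ ρ then 1 else 0 : ℝ) ≤ k * h := by
      refine (Finset.sum_le_sum fun j _ => near j).trans ?_
      simp
    have h2 := div_le_div_of_nonneg_right h1 hk.le
    have h3 := div_le_div_of_nonneg_right (far i) hk.le
    rw [mul_div_cancel_left₀ _ hk.ne'] at h2
    have h4 : (h : ℝ) / k ≤ h := div_le_self (by positivity) hk1
    have h5 := Int.floor_le ((Fintype.card V : ℝ) / k)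
    unfold score
    linarith
  · have hup := Finset.sum_le_sum fun v (_ : v ∈ Finset.univ) => contribution_le G u i ρ v
    rw [Finset.sum_add_distrib, Finset.sum_add_distrib, ← Finset.sum_div,
      ← Finset.sum_div, Finset.sum_comm (f := fun v j => if G.edist v (u j) ≤ (ρ + 1 : ℕ) then (0 : ℝ) else 1),
      Finset.sum_const, nsmul_eq_mul, Finset.card_univ, mul_one] at hup
    have h1 : (∑ j, ∑ v, if G.edist v (u j) ≤ (ρ + 1 : ℕ) then 0 else 1 : ℝ) ≤ k * h := by
      refine (Finset.sum_le_sum fun j _ => far j).trans ?_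
      simp
    have h2 := div_le_div_of_nonneg_right h1 hk.le
    rw [mul_div_cancel_left₀ _ hk.ne'] at h2
    have h3 := near i
    have h5 := Int.le_ceil ((Fintype.card V : ℝ) / k)
    unfold score
    linarith

theorem iterNbhd_ncard_le_succ [Fintype V] (G : SimpleGraph V) (i : ℕ) (v : V) :
    (iterNbhd G i v).ncard ≤ (iterNbhd G (i + 1) v).ncard :=
  Set.ncard_le_ncard fun w hw => ⟨w, hw, Or.inl rfl⟩

theorem TraversalConditions.hasThreshold [Fintype V] {G : SimpleGraph V} {k : ℕ} (hk : 2 ≤ k) {z : ℝ}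
    (h : TraversalConditions G k z) :
    HasThreshold G (min (Fintype.card V) (⌊z⌋₊ / 2)) := by
  obtain ⟨r, -, hfull, hsmall⟩ := h
  refine ⟨r - 1, fun v => ⟨le_min ?_ ?_, ?_⟩⟩
  · exact (Set.ncard_le_card _).trans_eq (Nat.card_eq_fintype_card)
  · rw [Nat.le_div_iff_mul_le two_pos]
    refine Nat.le_floor ?_
    have hk' : (2 : ℝ) ≤ k := by exact_mod_cast hk
    have h1 := (le_div_iff₀ (by linarith)).1 (hsmall v)
    push_cast
    nlinarith [Nat.cast_nonneg (α := ℝ) (iterNbhd G (r - 1) v).ncard]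
  · refine Nat.le_add_right_of_le ?_
    -- For r = 0 the truncated r - 1 is 0, so the ball of radius 1 has to be full; it contains the
    -- ball of radius 0, which already is.
    rcases r with _ | r
    · rw [← hfull v]
      exact iterNbhd_ncard_le_succ G 0 v
    · exact (hfull v).ge

end Certificate

/-! ### A program logic with running times. -/

section Hoare

/-- Started in `s`, the program `P` halts in a state and after a time that satisfy `R`. -/
def Run (P : Prog) (s : State) (R : State → ℕ → Prop) : Prop :=
  ∃ s' t, Exec P s s' t ∧ R s' t

theorem Run.mono {P : Prog} {s : State} {R R' : State → ℕ → Prop} (h : Run P s R)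
    (hR : ∀ s' t, R s' t → R' s' t) : Run P s R' := by
  obtain ⟨s', t, he, hr⟩ := h
  exact ⟨s', t, he, hR _ _ hr⟩

theorem Run.skip {s : State} {R : State → ℕ → Prop} (h : R s 1) : Run .skip s R :=
  ⟨_, _, .skip s, h⟩

theorem Run.assign {x : ℕ} {e : Expr} {s : State} {R : State → ℕ → Prop}
    (h : R (s.setVar x (e.eval s)) (e.cost + 1)) : Run (.assign x e) s R :=
  ⟨_, _, .assign s x e, h⟩

theorem Run.store {a : ℕ} {i e : Expr} {s : State} {R : State → ℕ → Prop}
    (h : R (s.setArr a (i.eval s) (e.eval s)) (i.cost + e.cost + 1)) : Run (.store a i e) s R :=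
  ⟨_, _, .store s a i e, h⟩

theorem Run.seq {P Q : Prog} {s : State} {R : State → ℕ → Prop}
    (h : Run P s fun s' t => Run Q s' fun s'' t' => R s'' (t + t')) : Run (.seq P Q) s R := by
  obtain ⟨s', t, he, s'', t', he', hr⟩ := h
  exact ⟨_, _, .seq he he', hr⟩

theorem Run.ite {b : Expr} {P Q : Prog} {s : State} {R : State → ℕ → Prop}
    (h₁ : b.eval s ≠ 0 → Run P s fun s' t => R s' (b.cost + 1 + t))
    (h₂ : b.eval s = 0 → Run Q s fun s' t => R s' (b.cost + 1 + t)) : Run (.ite b P Q) s R := by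
  by_cases hb : b.eval s = 0
  · obtain ⟨s', t, he, hr⟩ := h₂ hb
    exact ⟨_, _, .iteFalse hb he, hr⟩
  · obtain ⟨s', t, he, hr⟩ := h₁ hb
    exact ⟨_, _, .iteTrue hb he, hr⟩

/-- The loop rule: the invariant `I` may mention the time that has elapsed, and the measure `m`
decreases in every round. -/
theorem Run.loop {b : Expr} {P : Prog} {s : State} (I : State → ℕ → Prop) (m : State → ℕ)
    (h₀ : I s 0)
    (hstep : ∀ s t, I s t → b.eval s ≠ 0 →
      Run P s fun s' t' => I s' (t + (b.cost + 1 + t')) ∧ m s' < m s) :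
    Run (.loop b P) s fun s' t => ∃ t', I s' t' ∧ b.eval s' = 0 ∧ t = t' + (b.cost + 1) := by
  -- The time t already spent is generalized, so that the invariant always speaks of the total time
  -- since the loop was entered.
  suffices H : ∀ N s t, m s ≤ N → I s t →
      Run (.loop b P) s fun s' t'' =>
        ∃ t', I s' (t + t') ∧ b.eval s' = 0 ∧ t'' = t' + (b.cost + 1) by
    refine (H _ s 0 le_rfl h₀).mono fun s' t => ?_
    rintro ⟨t', h, h', h''⟩
    exact ⟨t', by simpa using h, h', h''⟩
  intro N
  induction N with
  | zero =>
    intro s t hN hI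
    by_cases hb : b.eval s = 0
    · exact ⟨s, _, .loopDone hb, 0, hI, hb, by omega⟩
    · obtain ⟨s', t', -, -, hlt⟩ := hstep s t hI hb
      omega
  | succ N ih =>
    intro s t hN hI
    by_cases hb : b.eval s = 0
    · exact ⟨s, _, .loopDone hb, 0, hI, hb, by omega⟩
    · obtain ⟨s', t', he, hI', hlt⟩ := hstep s t hI hb
      obtain ⟨s'', t'', he', t₃, hI'', hb', rfl⟩ := ih s' _ (by omega) hI'
      exact ⟨s'', _, .loopStep hb he he', b.cost + 1 + t' + t₃,
        by rwa [add_assoc] at hI'', hb', by omega⟩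

@[simp] theorem State.setVar_var (s : State) (x c y : ℕ) :
    (s.setVar x c).var y = if y = x then c else s.var y := by
  simp [State.setVar, Function.update_apply]

@[simp] theorem State.setVar_arr (s : State) (x c : ℕ) : (s.setVar x c).arr = s.arr := rfl

@[simp] theorem State.setArr_var (s : State) (a i c : ℕ) : (s.setArr a i c).var = s.var := rfl

@[simp] theorem State.setArr_arr (s : State) (a i c b : ℕ) :
    (s.setArr a i c).arr b = if b = a then Function.update (s.arr a) i c else s.arr b := by
  simp [State.setArr, Function.update_apply]

attribute [simp] Expr.eval Expr.cost

/-- The state `s'` has the same variables up to `7` and the same arrays `0` and `1` as `s`. -/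
structure SameInput (s s' : State) : Prop where
  var : ∀ x ≤ 7, s'.var x = s.var x
  arr : ∀ a ≤ 1, s'.arr a = s.arr a

theorem SameInput.refl (s : State) : SameInput s s := ⟨fun _ _ => rfl, fun _ _ => rfl⟩

theorem SameInput.trans {s s' s'' : State} (h : SameInput s s') (h' : SameInput s' s'') :
    SameInput s s'' :=
  ⟨fun x hx => (h'.var x hx).trans (h.var x hx), fun a ha => (h'.arr a ha).trans (h.arr a ha)⟩

theorem SameInput.setVar {s s' : State} (h : SameInput s s') {x : ℕ} (hx : 8 ≤ x) (c : ℕ) :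
    SameInput s (s'.setVar x c) :=
  ⟨fun y hy => by rw [State.setVar_var, if_neg (by omega)]; exact h.var y hy, h.arr⟩

theorem SameInput.setArr {s s' : State} (h : SameInput s s') {a : ℕ} (ha : 2 ≤ a) (i c : ℕ) :
    SameInput s (s'.setArr a i c) :=
  ⟨h.var, fun b hb => by rw [State.setArr_arr, if_neg (by omega)]; exact h.arr b hb⟩

end Hoare

/-! ### Breadth-first search as an abstract invariant. -/

section Bfs

variable {n : ℕ}

/-- Adjacency of the vertices with the numbers `a` and `b`. -/
def NumAdj (G : SimpleGraph (Fin n)) (a b : ℕ) : Prop :=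
  ∃ (ha : a < n) (hb : b < n), G.Adj ⟨a, ha⟩ ⟨b, hb⟩

/-- The invariant of breadth-first search from `v`: the marks `D`, the queue `Q` with the
levels `L` (the root has level `1`, and `n + 2` stands for infinity), of which the entries before
`head` are processed and the entries before `tail` are filled. -/
structure BfsInv (G : SimpleGraph (Fin n)) (v : Fin n) (D Q L : ℕ → ℕ) (head tail : ℕ) : Prop where
  head_le : head ≤ tail
  tail_pos : 0 < tail
  lt : ∀ i < tail, Q i < n
  marked : ∀ i < tail, D (Q i) ≠ 0
  inj : ∀ i < tail, ∀ j < tail, Q i = Q j → i = j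
  queued : ∀ w < n, D w ≠ 0 → ∃ i < tail, Q i = w
  queue_zero : Q 0 = v
  level_zero : L 0 = 1
  level_pos : ∀ i < tail, 1 ≤ L i
  level_mono : ∀ i j, i ≤ j → j < tail → L i ≤ L j
  level_le : ∀ i < tail, L i ≤ i + 1
  level_window : head < tail → ∀ i < tail, L i ≤ L head + 1
  sound : ∀ i < tail, ∀ h : Q i < n, (⟨Q i, h⟩ : Fin n) ∈ iterNbhd G (L i - 1) v
  closed : ∀ i < head, ∀ w, NumAdj G (Q i) w → ∃ j < tail, Q j = w ∧ L j ≤ L i + 1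
  level_inf : ∀ j, tail ≤ j → j < n → L j = n + 2

theorem BfsInv.init (G : SimpleGraph (Fin n)) (v : Fin n) {D Q L : ℕ → ℕ}
    (hD : ∀ w < n, D w = 0) (hL : ∀ j < n, L j = n + 2) :
    BfsInv G v (Function.update D v 1) (Function.update Q 0 v) (Function.update L 0 1) 0 1 where
  head_le := Nat.zero_le _
  tail_pos := one_pos
  lt i hi := by
    obtain rfl : i = 0 := by omega
    simp
  marked i hi := by
    obtain rfl : i = 0 := by omega
    simp
  inj i hi j hj _ := by omega
  queued w hw h := by
    by_cases hwv : w = v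
    · exact ⟨0, one_pos, by simp [hwv]⟩
    · rw [Function.update_of_ne hwv] at h
      exact absurd (hD w hw) h
  queue_zero := by simp
  level_zero := by simp
  level_pos i hi := by
    obtain rfl : i = 0 := by omega
    simp
  level_mono i j hij hj := by
    obtain rfl : i = j := by omega
    exact le_rfl
  level_le i hi := by
    obtain rfl : i = 0 := by omega
    simp
  level_window _ i hi := by
    obtain rfl : i = 0 := by omega
    simp
  sound i hi h := by
    obtain rfl : i = 0 := by omega
    simp [iterNbhd]
  closed i hi := by omega
  level_inf j hj hjn := by
    rw [Function.update_of_ne (by omega)]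
    exact hL j hjn

theorem BfsInv.tail_le {G : SimpleGraph (Fin n)} {v : Fin n} {D Q L : ℕ → ℕ} {head tail : ℕ}
    (h : BfsInv G v D Q L head tail) : tail ≤ n := by
  have := Finset.card_le_card_of_injOn (s := Finset.range tail) (t := Finset.range n) Q
    (fun i hi => by simpa using h.lt i (by simpa using hi))
    (fun i hi j hj hij => h.inj i (by simpa using hi) j (by simpa using hj) hij)
  simpa using this

/-- The new entry has level `L head + 1`, which by the window condition is at least every level in
the queue; hence levels stay sorted. It is fresh because its mark was zero. -/
theorem BfsInv.push {G : SimpleGraph (Fin n)} {v : Fin n} {D Q L : ℕ → ℕ} {head tail w : ℕ}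
    (h : BfsInv G v D Q L head tail) (hht : head < tail) (hw : NumAdj G (Q head) w)
    (hDw : D w = 0) :
    BfsInv G v (Function.update D w 1) (Function.update Q tail w)
      (Function.update L tail (L head + 1)) head (tail + 1) := by
  have hQ : ∀ i, i < tail → Function.update Q tail w i = Q i := fun i hi =>
    Function.update_of_ne (by omega) _ _
  have hL : ∀ i, i < tail → Function.update L tail (L head + 1) i = L i := fun i hi =>
    Function.update_of_ne (by omega) _ _
  have hQt : Function.update Q tail w tail = w := Function.update_self _ _ _
  have hLt : Function.update L tail (L head + 1) tail = L head + 1 := Function.update_self _ _ _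
  have hne : ∀ i < tail, Q i ≠ w := fun i hi hiw => h.marked i hi (hiw ▸ hDw)
  have hcases : ∀ i, i < tail + 1 → i < tail ∨ i = tail := fun i hi => by omega
  obtain ⟨hu, hwn, hadj⟩ := hw
  refine ⟨by omega, by omega, ?_, ?_, ?_, ?_, ?_, ?_, ?_, ?_, ?_, ?_, ?_, ?_, ?_⟩
  · intro i hi
    rcases hcases i hi with hi | rfl
    · rw [hQ i hi]; exact h.lt i hi
    · rwa [hQt]
  · intro i hi
    rcases hcases i hi with hi | rfl
    · rw [hQ i hi, Function.update_of_ne (hne i hi)]; exact h.marked i hi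
    · simp
  · intro i hi j hj hij
    rcases hcases i hi with hi | rfl <;> rcases hcases j hj with hj | rfl
    · rw [hQ i hi, hQ j hj] at hij; exact h.inj i hi j hj hij
    · rw [hQ i hi, hQt] at hij; exact absurd hij (hne i hi)
    · rw [hQ j hj, hQt] at hij; exact absurd hij.symm (hne j hj)
    · rfl
  · intro x hx hDx
    by_cases hxw : x = w
    · exact ⟨tail, by omega, by rw [hQt, hxw]⟩
    · rw [Function.update_of_ne hxw] at hDx
      obtain ⟨i, hi, hix⟩ := h.queued x hx hDx
      exact ⟨i, by omega, by rw [hQ i hi, hix]⟩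
  · rw [hQ 0 h.tail_pos]; exact h.queue_zero
  · rw [hL 0 h.tail_pos]; exact h.level_zero
  · intro i hi
    rcases hcases i hi with hi | rfl
    · rw [hL i hi]; exact h.level_pos i hi
    · rw [hLt]; omega
  · intro i j hij hj
    rcases hcases j hj with hj | rfl
    · rw [hL i (by omega), hL j hj]; exact h.level_mono i j hij hj
    · rcases hij.lt_or_eq with hi | rfl
      · rw [hL i hi, hLt]; exact h.level_window hht i hi
      · exact le_rfl
  · intro i hi
    rcases hcases i hi with hi | rfl
    · rw [hL i hi]; exact h.level_le i hi
    · rw [hLt]; have := h.level_le head hht; omega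
  · intro _ i hi
    rw [hL head hht]
    rcases hcases i hi with hi | rfl
    · rw [hL i hi]; exact h.level_window hht i hi
    · rw [hLt]
  · intro i hi hin
    rcases hcases i hi with hi | rfl
    · simp only [hQ i hi, hL i hi]; exact h.sound i hi _
    · simp only [hQt, hLt]
      obtain ⟨l, hl⟩ : ∃ l, L head = l + 1 := ⟨L head - 1, by have := h.level_pos head hht; omega⟩
      have hs := h.sound head hht hu
      rw [hl] at hs ⊢
      exact ⟨_, hs, Or.inr hadj⟩
  · intro i hi x hx
    rw [hQ i (by omega)] at hx
    obtain ⟨j, hj, hjx, hlj⟩ := h.closed i hi x hx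
    exact ⟨j, by omega, by rw [hQ j hj, hjx], by rwa [hL j hj, hL i (by omega)]⟩
  · intro j hj hjn
    rw [Function.update_of_ne (by omega)]
    exact h.level_inf j (by omega) hjn

theorem BfsInv.advance {G : SimpleGraph (Fin n)} {v : Fin n} {D Q L : ℕ → ℕ} {head tail : ℕ}
    (h : BfsInv G v D Q L head tail) (hht : head < tail)
    (hscan : ∀ w, NumAdj G (Q head) w → ∃ j < tail, Q j = w) :
    BfsInv G v D Q L (head + 1) tail where
  head_le := hht
  tail_pos := h.tail_pos
  lt := h.lt
  marked := h.marked
  inj := h.inj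
  queued := h.queued
  queue_zero := h.queue_zero
  level_zero := h.level_zero
  level_pos := h.level_pos
  level_mono := h.level_mono
  level_le := h.level_le
  level_window ht i hi := (h.level_window hht i hi).trans
    (Nat.add_le_add_right (h.level_mono _ _ (Nat.le_succ _) ht) 1)
  sound := h.sound
  closed i hi w hw := by
    rcases Nat.lt_succ_iff_lt_or_eq.1 hi with hi | rfl
    · exact h.closed i hi w hw
    · obtain ⟨j, hj, hjw⟩ := hscan w hw
      exact ⟨j, hj, hjw, h.level_window hht j hj⟩
  level_inf := h.level_inf

/-- Once the queue is exhausted every entry is processed, so each further hop raises the level by at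
most one. -/
theorem BfsInv.complete {G : SimpleGraph (Fin n)} {v : Fin n} {D Q L : ℕ → ℕ} {tail : ℕ}
    (h : BfsInv G v D Q L tail tail) (i : ℕ) (w : Fin n) (hw : w ∈ iterNbhd G i v) :
    ∃ j < tail, Q j = w ∧ L j ≤ i + 1 := by
  induction i generalizing w with
  | zero => exact ⟨0, h.tail_pos, by rw [h.queue_zero, Set.mem_singleton_iff.1 hw],
      by rw [h.level_zero]⟩
  | succ i ih =>
    obtain ⟨x, hx, rfl | hxw⟩ := hw
    · obtain ⟨j, hj, hjw, hl⟩ := ih _ hx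
      exact ⟨j, hj, hjw, by omega⟩
    · obtain ⟨j, hj, hjx, hl⟩ := ih _ hx
      obtain ⟨l, hl', hlw, hll⟩ := h.closed j hj w ⟨by rw [hjx]; exact x.2, w.2, by simpa [hjx]⟩
      exact ⟨l, hl', hlw, by omega⟩

theorem iterNbhd_mono {V : Type*} (G : SimpleGraph V) (v : V) {i j : ℕ} (hij : i ≤ j) :
    iterNbhd G i v ⊆ iterNbhd G j v := fun w hw =>
  (mem_iterNbhd_iff G j v w).2 (((mem_iterNbhd_iff G i v w).1 hw).trans (by exact_mod_cast hij))

/-- After breadth-first search, the levels in the order of the queue determine the sizes of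
the neighborhoods. -/
def LevelSpec (G : SimpleGraph (Fin n)) (v : Fin n) (L : ℕ → ℕ) : Prop :=
  ∀ j < n, (L j = n + 2 ∧ ∀ i, (iterNbhd G i v).ncard ≤ j) ∨
    (L j ≤ n ∧ ∀ i, L j ≤ i + 1 ↔ j < (iterNbhd G i v).ncard)

/-- Levels are sorted along the queue, so the entries of level at most i + 1 form an initial
segment. By soundness and completeness they are exactly the vertices of N_i(v), so comparing a
position with the size of the ball amounts to comparing its level with i + 1. -/
theorem BfsInv.levelSpec {G : SimpleGraph (Fin n)} {v : Fin n} {D Q L : ℕ → ℕ} {tail : ℕ}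
    (h : BfsInv G v D Q L tail tail) : LevelSpec G v L := by
  intro j hjn
  -- The map f sends a vertex to its queue position; it is injective since Q recovers the vertex.
  have card_le : ∀ i m, (∀ l < tail, L l ≤ i + 1 → l < m) → (iterNbhd G i v).ncard ≤ m := by
    intro i m hm
    choose! f hf using h.complete i
    have := Set.ncard_le_ncard_of_injOn (s := iterNbhd G i v) (t := (Finset.range m : Set ℕ)) f
      (fun w hw => by simpa using hm _ (hf w hw).1 (hf w hw).2.2)
      (fun w hw x hx hwx => Fin.ext (by
        simpa [(hf w hw).2.1, (hf x hx).2.1] using congrArg Q hwx))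
    simpa [Set.ncard_coe_finset] using this
  rcases le_or_gt tail j with hj | hj
  · exact Or.inl ⟨h.level_inf j hj hjn, fun i => card_le i j fun l hl _ => by omega⟩
  · refine Or.inr ⟨(h.level_le j hj).trans hjn, fun i => ⟨fun hl => ?_, fun hlt => ?_⟩⟩
    · have := Set.ncard_le_ncard_of_injOn (s := (Finset.range (j + 1) : Set ℕ))
        (t := iterNbhd G i v) (fun l => if hl : Q l < n then ⟨Q l, hl⟩ else v)
        (fun l hl' => by
          have hl' : l < j + 1 := by simpa using hl'
          have hlt := h.lt l (by omega)
          simp only [hlt, dif_pos]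
          refine iterNbhd_mono G v ?_ (h.sound l (by omega) hlt)
          have := h.level_mono l j (by omega) hj
          omega)
        (fun l hl' m hm' hlm => by
          have hl' : l < j + 1 := by simpa using hl'
          have hm' : m < j + 1 := by simpa using hm'
          have hlt := h.lt l (by omega)
          have hmt := h.lt m (by omega)
          simp only [hlt, hmt, dif_pos, Fin.mk.injEq] at hlm
          exact h.inj l (by omega) m (by omega) hlm)
      rw [Set.ncard_coe_finset, Finset.card_range] at this
      omega
    · by_contra hl
      have := card_le i j fun l hl' hli => by
        by_contra hjl
        have := h.level_mono j l (by omega) hl'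
        omega
      omega

end Bfs

/-! ### The input encoding by adjacency lists. -/

section AdjacencyLists

variable {n : ℕ} (G : SimpleGraph (Fin n))

/-- The position at which the adjacency list of the vertex `j` starts. -/
noncomputable def adjStart (j : ℕ) : ℕ := (adjConcat G j).length

theorem adjConcat_succ (u : Fin n) :
    adjConcat G (u + 1) = adjConcat G u ++ adjList G u := by
  have h : (u : ℕ) < (List.finRange n).length := by simp
  rw [adjConcat, List.take_succ_eq_append_getElem h]
  simp [adjConcat]

theorem adjStart_succ (u : Fin n) : adjStart G (u + 1) = adjStart G u + (adjList G u).length := by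
  simp [adjStart, adjConcat_succ]

theorem adjConcat_prefix (u : Fin n) : adjConcat G (u + 1) <+: adjConcat G n := by
  obtain ⟨t, ht⟩ : (List.finRange n).take (u + 1) <+: (List.finRange n).take n :=
    List.take_prefix_take_left (by omega)
  exact ⟨t.flatMap (adjList G), by rw [adjConcat, adjConcat, ← List.flatMap_append, ht]⟩

theorem adjConcat_getD (u : Fin n) {q : ℕ} (hq : q < (adjList G u).length) :
    (adjConcat G n).getD (adjStart G u + q) 0 = (adjList G u)[q] := by
  obtain ⟨t, ht⟩ := adjConcat_prefix G u
  rw [← ht, adjConcat_succ, adjStart, List.append_assoc, List.getD_append_right _ _ _ _ (by omega),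
    List.getD_append _ _ _ _ (by omega)]
  simp [hq]

open scoped Classical in
theorem adjList_eq_map (u : Fin n) :
    adjList G u = ((List.finRange n).filter fun w => G.Adj u w).map Fin.val := by
  simp only [adjList, List.pure_def, List.bind_eq_flatMap, List.map_flatMap, List.map_singleton]
  exact List.map_eq_flatMap.symm

theorem mem_adjList {u : Fin n} {w : ℕ} : w ∈ adjList G u ↔ NumAdj G u w := by
  simp only [adjList_eq_map, List.mem_map, List.mem_filter, List.mem_finRange, true_and, NumAdj,
    decide_eq_true_eq]
  constructor
  · rintro ⟨x, hx, rfl⟩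
    exact ⟨u.2, x.2, hx⟩
  · rintro ⟨_, hw, h⟩
    exact ⟨⟨w, hw⟩, h, rfl⟩

theorem numAdj_getD {u : ℕ} (hu : u < n) {q : ℕ} (h₁ : adjStart G u ≤ q)
    (h₂ : q < adjStart G (u + 1)) : NumAdj G u ((adjConcat G n).getD q 0) := by
  have h₃ := adjStart_succ G ⟨u, hu⟩
  obtain ⟨r, rfl⟩ := Nat.exists_eq_add_of_le h₁
  have hr : r < (adjList G ⟨u, hu⟩).length := by simp only at h₃; omega
  rw [adjConcat_getD G ⟨u, hu⟩ hr]
  exact (mem_adjList G (u := ⟨u, hu⟩)).1 (List.getElem_mem _)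

theorem exists_getD_of_numAdj {u w : ℕ} (h : NumAdj G u w) :
    ∃ q, adjStart G u ≤ q ∧ q < adjStart G (u + 1) ∧ (adjConcat G n).getD q 0 = w := by
  have hu := h.1
  obtain ⟨r, hr, hrw⟩ := List.mem_iff_getElem.1 ((mem_adjList G (u := ⟨u, hu⟩)).2 h)
  have h₃ := adjStart_succ G ⟨u, hu⟩
  exact ⟨adjStart G u + r, by omega, by simp only at h₃; omega,
    (adjConcat_getD G ⟨u, hu⟩ hr).trans hrw⟩

theorem adjStart_eq_sum {j : ℕ} (hj : j ≤ n) :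
    adjStart G j = ∑ u ∈ Finset.range j, (adjStart G (u + 1) - adjStart G u) := by
  induction j with
  | zero => simp [adjStart, adjConcat]
  | succ j ih =>
    rw [Finset.sum_range_succ, ← ih (by omega)]
    have := adjStart_succ G ⟨j, hj⟩
    simp only at this
    omega

/-- The list lengths are the degrees, so this is the handshake lemma. -/
theorem adjStart_le : adjStart G n ≤ 2 * G.edgeSet.ncard := by
  classical
  have hlen : ∀ u, (adjList G u).length = G.degree u := by
    intro u
    rw [adjList_eq_map, List.length_map, ← SimpleGraph.card_neighborFinset_eq_degree,
      ← List.toFinset_card_of_nodup ((List.nodup_finRange n).filter _)]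
    congr 1
    ext w
    simp
  have h : adjStart G n = ∑ u, G.degree u := by
    rw [adjStart, adjConcat, List.take_of_length_le (by simp), List.length_flatMap]
    simp only [hlen]
    rw [← List.ofFn_eq_map, List.sum_ofFn]
  rw [h, SimpleGraph.sum_degrees_eq_twice_card_edges, ← SimpleGraph.coe_edgeFinset,
    Set.ncard_coe_finset]

end AdjacencyLists

/-! ### Correctness and cost of the search program. -/

section Search

open FacilityGame.Prog FacilityGame.Expr

/-- Clear the marks and set all levels to infinity. -/
def resetProg : Prog :=
  seq (assign 8 (const 0)) (loop (le (add (var 8) (const 1)) (var 1))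
    (seq (store 2 (var 8) (const 0)) (seq (store 4 (var 8) (add (var 1) (const 2)))
      (assign 8 (add (var 8) (const 1))))))

theorem run_resetProg (s : State) :
    Run resetProg s fun s' t => SameInput s s' ∧ (∀ w < s.var 1, s'.arr 2 w = 0) ∧
      (∀ j < s.var 1, s'.arr 4 j = s.var 1 + 2) ∧ t ≤ 30 * s.var 1 + 30 := by
  refine .seq (.assign ?_)
  refine (Run.loop (fun s' t => SameInput s s' ∧ s'.var 8 ≤ s.var 1 ∧
    (∀ w < s'.var 8, s'.arr 2 w = 0) ∧ (∀ j < s'.var 8, s'.arr 4 j = s.var 1 + 2) ∧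
    t ≤ 30 * s'.var 8) (fun s' => s.var 1 - s'.var 8) ?_ ?_).mono ?_
  · exact ⟨(SameInput.refl s).setVar (by norm_num) _, by simp, by simp, by simp, by simp⟩
  · rintro s' t ⟨hs, hle, hD, hL, ht⟩ hb
    have h1 := hs.var 1 (by norm_num)
    have hlt : s'.var 8 < s.var 1 := by
      by_contra hlt
      simp [h1, hlt] at hb
    refine .seq (.store (.seq (.store (.assign ⟨⟨?_, ?_, ?_, ?_, ?_⟩, ?_⟩))))
    · exact ((hs.setArr (by norm_num) _ _).setArr (by norm_num) _ _).setVar (by norm_num) _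
    · simpa using hlt
    · intro w hw
      have hw : w < s'.var 8 + 1 := by simpa using hw
      by_cases hws : w = s'.var 8
      · simp [hws]
      · simpa [Function.update_of_ne hws] using hD w (by omega)
    · intro w hw
      have hw : w < s'.var 8 + 1 := by simpa using hw
      by_cases hws : w = s'.var 8
      · simp [hws, h1]
      · simpa [Function.update_of_ne hws] using hL w (by omega)
    · simp; omega
    · simp; omega
  · rintro s' t ⟨t', ⟨hs, hle, hD, hL, ht⟩, hb, rfl⟩
    have h1 := hs.var 1 (by norm_num)
    have heq : s'.var 8 = s.var 1 := by
      simp [h1] at hb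
      omega
    rw [heq] at hD hL ht
    refine ⟨hs, hD, hL, ?_⟩
    simp
    omega

/-- Scan the rest of the adjacency list of the head of the queue, from position `var 11` on. -/
def scanProg : Prog :=
  loop (le (add (var 11) (const 1)) (get 0 (add (get 3 (var 9)) (const 1))))
    (seq (assign 12 (get 1 (var 11)))
      (seq (ite (get 2 (var 12)) skip
        (seq (store 2 (var 12) (const 1)) (seq (store 3 (var 10) (var 12))
          (seq (store 4 (var 10) (add (get 4 (var 9)) (const 1)))
            (assign 10 (add (var 10) (const 1)))))))
        (assign 11 (add (var 11) (const 1)))))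

/-- The state `s` holds the graph `G`. -/
structure HoldsGraph {n : ℕ} (G : SimpleGraph (Fin n)) (s : State) : Prop where
  size : s.var 1 = n
  start : ∀ j ≤ n, s.arr 0 j = adjStart G j
  adj : ∀ q, s.arr 1 q = (adjConcat G n).getD q 0

theorem HoldsGraph.congr {n : ℕ} {G : SimpleGraph (Fin n)} {s s' : State} (h : HoldsGraph G s)
    (hs : SameInput s s') : HoldsGraph G s' where
  size := (hs.var 1 (by norm_num)).trans h.size
  start j hj := by rw [hs.arr 0 (by norm_num)]; exact h.start j hj
  adj q := by rw [hs.arr 1 le_rfl]; exact h.adj q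

/-- The cost is charged to the length of the list being scanned. The invariant records that every
list entry before the current position is already in the queue, which at the end is what
`BfsInv.advance` needs. -/
theorem run_scanProg {n : ℕ} {G : SimpleGraph (Fin n)} {v : Fin n} {s : State}
    (hG : HoldsGraph G s)
    (hI : BfsInv G v (s.arr 2) (s.arr 3) (s.arr 4) (s.var 9) (s.var 10))
    (hht : s.var 9 < s.var 10) (hp : s.var 11 = adjStart G (s.arr 3 (s.var 9))) :
    Run scanProg s fun s' t => SameInput s s' ∧ s'.var 9 = s.var 9 ∧ s'.var 9 < s'.var 10 ∧
      BfsInv G v (s'.arr 2) (s'.arr 3) (s'.arr 4) (s'.var 9) (s'.var 10) ∧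
      (∀ i ≤ s.var 9, s'.arr 3 i = s.arr 3 i) ∧
      (∀ w, NumAdj G (s'.arr 3 (s'.var 9)) w → ∃ j < s'.var 10, s'.arr 3 j = w) ∧
      t ≤ 50 * (adjStart G (s.arr 3 (s.var 9) + 1) - adjStart G (s.arr 3 (s.var 9))) + 50 := by
  set u := s.arr 3 (s.var 9) with hu
  have hun : u < n := hI.lt _ hht
  refine (Run.loop (fun s' t => SameInput s s' ∧ s'.var 9 = s.var 9 ∧ s'.var 9 < s'.var 10 ∧
    BfsInv G v (s'.arr 2) (s'.arr 3) (s'.arr 4) (s'.var 9) (s'.var 10) ∧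
    (∀ i ≤ s.var 9, s'.arr 3 i = s.arr 3 i) ∧
    (adjStart G u ≤ s'.var 11 ∧ s'.var 11 ≤ adjStart G (u + 1)) ∧
    (∀ q, adjStart G u ≤ q → q < s'.var 11 → ∃ j < s'.var 10,
      s'.arr 3 j = (adjConcat G n).getD q 0) ∧ t ≤ 50 * (s'.var 11 - adjStart G u))
    (fun s' => adjStart G (u + 1) - s'.var 11) ?_ ?_).mono ?_
  · refine ⟨.refl s, rfl, hht, hI, fun _ _ => rfl, ⟨hp.ge, ?_⟩, fun q h₁ h₂ => by omega,
      Nat.zero_le _⟩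
    have := adjStart_succ G ⟨u, hun⟩
    simp only at this
    omega
  · rintro s' t ⟨hs, h9, hht', hI', hQ, ⟨hp₁, hp₂⟩, hscan, ht⟩ hb
    have hG' := hG.congr hs
    have hend : s'.arr 0 (u + 1) = adjStart G (u + 1) := hG'.start _ hun
    have hhead : s'.arr 3 (s'.var 9) = u := by rw [h9, hQ _ le_rfl]
    have hlt : s'.var 11 < adjStart G (u + 1) := by
      by_contra hlt
      simp [hhead, hend] at hb
      omega
    have hw := numAdj_getD G hun hp₁ hlt
    rw [← hG'.adj] at hw
    refine .seq (.assign (.seq (.ite (fun hm => .skip (.assign ?_)) fun hm =>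
      .seq (.store (.seq (.store (.seq (.store (.assign (.assign ?_)))))))))) <;>
    simp at hm
    · refine ⟨⟨(hs.setVar (by norm_num) _).setVar (by norm_num) _, ?_, ?_, ?_, ?_, ?_, ?_, ?_⟩, ?_⟩
      · simpa using h9
      · simpa using hht'
      · simpa using hI'
      · simpa using hQ
      · simp; omega
      · intro q hq₁ hq₂
        have hq₂ : q < s'.var 11 + 1 := by simpa using hq₂
        by_cases hq : q = s'.var 11
        · rw [hq, ← hG'.adj]
          simpa using hI'.queued _ hw.2.1 hm
        · simpa using hscan q hq₁ (by omega)
      · simp; omega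
      · simp; omega
    · have hne : s'.var 9 ≠ s'.var 10 := by omega
      have hpush := hI'.push hht' (hhead ▸ hw) hm
      have hold : ∀ i < s'.var 10,
          Function.update (s'.arr 3) (s'.var 10) (s'.arr 1 (s'.var 11)) i = s'.arr 3 i :=
        fun i hi => Function.update_of_ne (by omega) _ _
      refine ⟨⟨?_, ?_, ?_, ?_, ?_, ?_, ?_, ?_⟩, ?_⟩
      · exact (((((hs.setVar (by norm_num) _).setArr (by norm_num) _ _).setArr (by norm_num) _
          _).setArr (by norm_num) _ _).setVar (by norm_num) _).setVar (by norm_num) _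
      · simpa using h9
      · simp; omega
      · simpa using hpush
      · intro i hi
        simpa [hold i (by omega)] using hQ i hi
      · simp; omega
      · intro q hq₁ hq₂
        have hq₂ : q < s'.var 11 + 1 := by simpa using hq₂
        by_cases hq : q = s'.var 11
        · exact ⟨s'.var 10, by simp, by rw [hq, ← hG'.adj]; simp⟩
        · obtain ⟨j, hj, hjq⟩ := hscan q hq₁ (by omega)
          exact ⟨j, by simp; omega, by simpa [hold j hj] using hjq⟩
      · simp; omega
      · simp; omega
  · rintro s' t ⟨t', ⟨hs, h9, hht', hI', hQ, ⟨hp₁, hp₂⟩, hscan, ht⟩, hb, rfl⟩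
    have hG' := hG.congr hs
    have hend : s'.arr 0 (u + 1) = adjStart G (u + 1) := hG'.start _ hun
    have hhead : s'.arr 3 (s'.var 9) = u := by rw [h9, hQ _ le_rfl]
    have hge : adjStart G (u + 1) ≤ s'.var 11 := by
      simp [hhead, hend] at hb
      omega
    refine ⟨hs, h9, hht', hI', hQ, fun w hw => ?_, by simp; omega⟩
    obtain ⟨q, hq₁, hq₂, rfl⟩ := exists_getD_of_numAdj G (hhead ▸ hw)
    exact hscan q hq₁ (by omega)

/-- Breadth-first search from the vertex in `var 5`. -/
def bfsProg : Prog :=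
  seq resetProg (seq (store 2 (var 5) (const 1)) (seq (store 3 (const 0) (var 5))
    (seq (store 4 (const 0) (const 1)) (seq (assign 9 (const 0)) (seq (assign 10 (const 1))
      (loop (le (add (var 9) (const 1)) (var 10))
        (seq (assign 11 (get 0 (get 3 (var 9))))
          (seq scanProg (assign 9 (add (var 9) (const 1)))))))))))

theorem run_bfsProg {n : ℕ} {G : SimpleGraph (Fin n)} {v : Fin n} {s : State}
    (hG : HoldsGraph G s) (hv : s.var 5 = v) :
    Run bfsProg s fun s' t => SameInput s s' ∧ LevelSpec G v (s'.arr 4) ∧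
      t ≤ 200 * (G.edgeSet.ncard + n) + 100 := by
  refine .seq ((run_resetProg s).mono fun s₁ t₁ => ?_)
  rintro ⟨hs₁, hD, hL, ht₁⟩
  rw [hG.size] at hD hL ht₁
  refine .seq (.store (.seq (.store (.seq (.store (.seq (.assign (.seq (.assign ?_)))))))))
  have hv₁ : s₁.var 5 = v := (hs₁.var 5 (by norm_num)).trans hv
  refine (Run.loop (fun s' t => SameInput s s' ∧
    BfsInv G v (s'.arr 2) (s'.arr 3) (s'.arr 4) (s'.var 9) (s'.var 10) ∧
    t ≤ ∑ i ∈ Finset.range (s'.var 9),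
      (50 * (adjStart G (s'.arr 3 i + 1) - adjStart G (s'.arr 3 i)) + 70))
    (fun s' => n - s'.var 9) ?_ ?_).mono ?_
  · refine ⟨?_, ?_, Nat.zero_le _⟩
    · exact ((((hs₁.setArr (by norm_num) _ _).setArr (by norm_num) _ _).setArr (by norm_num) _
        _).setVar (by norm_num) _).setVar (by norm_num) _
    · simpa [hv₁] using BfsInv.init G v (Q := s₁.arr 3) hD hL
  · rintro s' t ⟨hs, hI, ht⟩ hb
    have hG' := hG.congr hs
    have hht : s'.var 9 < s'.var 10 := by
      by_contra hlt
      simp at hb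
      omega
    have hun := hI.lt _ hht
    refine .seq (.assign (.seq ((run_scanProg (v := v)
      (hG'.congr ((SameInput.refl s').setVar (by norm_num) _)) (by simpa using hI)
      (by simpa using hht) (by simpa using hG'.start _ hun.le)).mono fun s'' t'' => ?_)))
    rintro ⟨hs'', h9, hht'', hI'', hQ, hscan, ht''⟩
    simp only [State.setVar_var, State.setVar_arr, Nat.reduceEqDiff, if_false] at h9 hQ ht''
    refine .assign ⟨⟨?_, ?_, ?_⟩, ?_⟩
    · exact ((hs.setVar (by norm_num) _).trans hs'').setVar (by norm_num) _
    · simpa using hI''.advance hht'' hscan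
    · simp only [State.setVar_var, State.setVar_arr, Expr.eval, if_true, h9, Expr.cost]
      rw [Finset.sum_range_succ, hQ _ le_rfl, Finset.sum_congr rfl fun i hi => by
        rw [hQ i (Finset.mem_range.1 hi).le]]
      omega
    · have := hI.tail_le
      simp [h9]
      omega
  · rintro s' t ⟨t', ⟨hs, hI, ht⟩, hb, rfl⟩
    have heq : s'.var 9 = s'.var 10 := by
      simp at hb
      have := hI.head_le
      omega
    rw [heq] at hI ht
    refine ⟨hs, hI.levelSpec, ?_⟩
    -- No vertex is queued twice, so the scanning costs add up to at most the sum over all vertices,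
    -- which telescopes to the total length of the lists.
    have hsum : ∑ i ∈ Finset.range (s'.var 10),
        (50 * (adjStart G (s'.arr 3 i + 1) - adjStart G (s'.arr 3 i)) + 70) ≤
        ∑ u ∈ Finset.range n, (50 * (adjStart G (u + 1) - adjStart G u) + 70) := by
      rw [← Finset.sum_image (s := Finset.range (s'.var 10)) (g := s'.arr 3)
        (f := fun u => 50 * (adjStart G (u + 1) - adjStart G u) + 70)
        fun i hi j hj hij => hI.inj i (by simpa using hi) j (by simpa using hj) hij]
      refine Finset.sum_le_sum_of_subset fun u hu => ?_
      obtain ⟨i, hi, rfl⟩ := Finset.mem_image.1 hu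
      exact Finset.mem_range.2 (hI.lt i (Finset.mem_range.1 hi))
    rw [Finset.sum_add_distrib (s := Finset.range n), ← Finset.mul_sum (s := Finset.range n),
      ← adjStart_eq_sum G le_rfl, Finset.sum_const, Finset.card_range, smul_eq_mul] at hsum
    have := adjStart_le G
    simp
    omega

end Search

/-! ### Deciding the existence of a threshold radius. -/

section Decision

open FacilityGame.Prog FacilityGame.Expr

variable {n : ℕ}

/-- `A` and `B` bound the radii `ρ` for which the threshold conditions hold at the vertices
with numbers below `i`: these are the `ρ` with `B ≤ ρ + 2 ≤ A`, up to truncation. -/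
structure RadiusBounds (G : SimpleGraph (Fin n)) (h i A B : ℕ) : Prop where
  two_le : 2 ≤ B
  min_le : ∀ ρ, (∀ v : Fin n, (v : ℕ) < i → (iterNbhd G ρ v).ncard ≤ h) →
    min (ρ + 2) (n + 2) ≤ A
  small : ∀ ρ, ρ + 2 ≤ A → ∀ v : Fin n, (v : ℕ) < i → (iterNbhd G ρ v).ncard ≤ h
  le_min : ∀ ρ, (∀ v : Fin n, (v : ℕ) < i → n ≤ (iterNbhd G (ρ + 1) v).ncard + h) →
    B ≤ ρ + 2 ∧ B ≤ n + 1
  large : ∀ ρ, ρ + 2 ≤ n + 1 → B ≤ ρ + 2 →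
    ∀ v : Fin n, (v : ℕ) < i → n ≤ (iterNbhd G (ρ + 1) v).ncard + h

theorem RadiusBounds.init (G : SimpleGraph (Fin n)) (h : ℕ) (hn : 0 < n) :
    RadiusBounds G h 0 (n + 2) 2 where
  two_le := le_rfl
  min_le ρ _ := by omega
  small ρ _ v hv := by omega
  le_min ρ _ := by omega
  large ρ _ _ v hv := by omega

/-- Truncated subtraction expresses the minimum as A - (A - x) and the maximum as B + (x - B). With
levels shifted by one, |N_ρ(v)| ≤ h means ρ + 2 ≤ L h, and |N_{ρ+1}(v)| ≥ n - h means L (n - h - 1)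
≤ ρ + 2. The value n + 2 stands for an unreached position: harmless for the minimum, fatal for the
maximum. -/
theorem RadiusBounds.step {G : SimpleGraph (Fin n)} {h A B : ℕ} (v : Fin n) {L : ℕ → ℕ}
    (hb : RadiusBounds G h v A B) (hL : LevelSpec G v L) (hh : h < n) :
    RadiusBounds G h (v + 1) (A - (A - L h)) (B + (L (n - h - 1) - B)) := by
  have hlast : ∀ P : Fin n → Prop, (∀ w : Fin n, (w : ℕ) < v + 1 → P w) ↔
      (∀ w : Fin n, (w : ℕ) < v → P w) ∧ P v := by
    intro P
    refine ⟨fun H => ⟨fun w hw => H w (by omega), H v (by omega)⟩, fun H w hw => ?_⟩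
    by_cases hwv : w = v
    · exact hwv ▸ H.2
    · exact H.1 w (by have := Fin.val_ne_of_ne hwv; omega)
  have h₁ := hL h hh
  have h₂ := hL (n - h - 1) (by omega)
  have htwo := hb.two_le
  refine ⟨by omega, fun ρ hρ => ?_, fun ρ hρ => (hlast _).2 ⟨?_, ?_⟩, fun ρ hρ => ?_,
    fun ρ hρn hρ => (hlast _).2 ⟨?_, ?_⟩⟩
  · obtain ⟨hρ, hρv⟩ := (hlast _).1 hρ
    have hA := hb.min_le ρ hρ
    rcases h₁ with ⟨h₁, -⟩ | ⟨-, h₁⟩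
    · omega
    · have := h₁ ρ
      omega
  · exact hb.small ρ (by omega)
  · rcases h₁ with ⟨-, h₁⟩ | ⟨-, h₁⟩
    · exact h₁ ρ
    · have := h₁ ρ
      omega
  · obtain ⟨hρ, hρv⟩ := (hlast _).1 hρ
    have hB := hb.le_min ρ hρ
    rcases h₂ with ⟨-, h₂⟩ | ⟨h₂, h₃⟩
    · have := h₂ (ρ + 1)
      omega
    · have := h₃ (ρ + 1)
      omega
  · exact hb.large ρ hρn (by omega)
  · rcases h₂ with ⟨h₂, -⟩ | ⟨-, h₂⟩
    · omega
    · have := h₂ (ρ + 1)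
      omega

/-- The admissible ρ + 2 fill the interval from B to A, so ρ = B - 2 serves as soon as any radius
does; B ≥ 2 makes this a natural number. -/
theorem RadiusBounds.hasThreshold_iff {G : SimpleGraph (Fin n)} {h A B : ℕ}
    (hb : RadiusBounds G h n A B) : HasThreshold G h ↔ B ≤ A ∧ B < n + 2 := by
  have htwo := hb.two_le
  constructor
  · rintro ⟨ρ, hρ⟩
    have h₁ := hb.min_le ρ fun v _ => (hρ v).1
    have h₂ := hb.le_min ρ fun v _ => by simpa using (hρ v).2
    omega
  · rintro ⟨h₁, h₂⟩
    refine ⟨B - 2, fun v => ⟨hb.small _ (by omega) v v.2, ?_⟩⟩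
    simpa using hb.large (B - 2) (by omega) (by omega) v v.2

/-- Compute `min n (z / 2)` in variable `4`. -/
def thresholdProg : Prog :=
  -- The truncated difference of two truth values means "the first and not the second"; with c in
  -- variable 4 the guard says 2(c + 1) ≤ z and c < n.
  loop (sub (le (add (var 4) (add (var 4) (const 2))) (var 3)) (le (var 1) (var 4)))
    (assign 4 (add (var 4) (const 1)))

theorem State.setVar_setVar (s : State) (x c c' : ℕ) :
    (s.setVar x c).setVar x c' = s.setVar x c' := by
  simp [State.setVar]

theorem run_thresholdProg {s : State} (h4 : s.var 4 = 0) :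
    Run thresholdProg s fun s' t =>
      s' = s.setVar 4 (min (s.var 1) (s.var 3 / 2)) ∧ t ≤ 30 * s.var 1 + 30 := by
  refine (Run.loop (fun s' t => ∃ c, s' = s.setVar 4 c ∧ c ≤ s.var 1 ∧ c ≤ s.var 3 / 2 ∧
    t ≤ 30 * c) (fun s' => s.var 1 - s'.var 4) ?_ ?_).mono ?_
  · refine ⟨0, ?_, Nat.zero_le _, Nat.zero_le _, le_rfl⟩
    rw [← h4]
    simp [State.setVar]
  · rintro _ t ⟨c, rfl, hc, hcz, ht⟩ hb
    simp at hb
    have : c + (c + 2) ≤ s.var 3 ∧ ¬ s.var 1 ≤ c := by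
      constructor
      · by_contra h
        simp [h] at hb
      · intro h
        simp [h] at hb
        split_ifs at hb <;> omega
    refine .assign ⟨⟨c + 1, ?_, by omega, by omega, ?_⟩, ?_⟩
    · simp [State.setVar_setVar]
    · simp; omega
    · simp; omega
  · rintro _ t ⟨t', ⟨c, rfl, hc, hcz, ht⟩, hb, rfl⟩
    have : ¬ (c + (c + 2) ≤ s.var 3) ∨ s.var 1 ≤ c := by
      by_contra h
      push Not at h
      simp [h.1, not_le.2 h.2] at hb
    refine ⟨?_, by simp; omega⟩
    congr 1
    omega

/-- Search from all vertices, and maintain the bounds for the radius in the variables `6`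
and `7`. -/
def searchProg : Prog :=
  seq (assign 6 (add (var 1) (const 2))) (seq (assign 7 (const 2))
    (loop (le (add (var 5) (const 1)) (var 1))
      (seq bfsProg (seq (assign 6 (sub (var 6) (sub (var 6) (get 4 (var 4)))))
        (seq (assign 7 (add (var 7) (sub (get 4 (sub (sub (var 1) (var 4)) (const 1))) (var 7))))
          (assign 5 (add (var 5) (const 1))))))))

theorem HoldsGraph.setVar {G : SimpleGraph (Fin n)} {s : State} (h : HoldsGraph G s) {x : ℕ}
    (hx : x ≠ 1) (c : ℕ) : HoldsGraph G (s.setVar x c) where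
  size := by rw [State.setVar_var, if_neg hx.symm]; exact h.size
  start := h.start
  adj := h.adj

theorem run_searchProg {G : SimpleGraph (Fin n)} {s : State} (hG : HoldsGraph G s)
    (h5 : s.var 5 = 0) (hlt : s.var 4 < n) :
    Run searchProg s fun s' t => s'.var 1 = n ∧
      (HasThreshold G (s.var 4) ↔ s'.var 7 ≤ s'.var 6 ∧ s'.var 7 < n + 2) ∧
      t ≤ n * (200 * (G.edgeSet.ncard + n) + 150) + 50 := by
  refine .seq (.assign (.seq (.assign ((Run.loop (fun s' t => HoldsGraph G s' ∧
    s'.var 4 = s.var 4 ∧ s'.var 5 ≤ n ∧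
    RadiusBounds G (s.var 4) (s'.var 5) (s'.var 6) (s'.var 7) ∧
    t ≤ s'.var 5 * (200 * (G.edgeSet.ncard + n) + 150)) (fun s' => n - s'.var 5) ?_ ?_).mono ?_))))
  · refine ⟨(hG.setVar (by norm_num) _).setVar (by norm_num) _, by simp, by simp [h5], ?_, by simp⟩
    simpa [h5, hG.size] using RadiusBounds.init G (s.var 4) (by omega)
  · rintro s' t ⟨hG', h4, hle, hR, ht⟩ hb
    have hv : s'.var 5 < n := by
      by_contra hlt
      simp [hG'.size] at hb
      omega
    refine .seq ((run_bfsProg (v := ⟨s'.var 5, hv⟩) hG' rfl).mono fun s'' t'' => ?_)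
    rintro ⟨hs, hL, ht''⟩
    have e1 := hs.var 1 (by norm_num)
    have e4 := hs.var 4 (by norm_num)
    have e5 := hs.var 5 (by norm_num)
    have e6 := hs.var 6 (by norm_num)
    have e7 := hs.var 7 (by norm_num)
    have hstep := hR.step ⟨s'.var 5, hv⟩ hL hlt
    refine .seq (.assign (.seq (.assign (.assign ⟨⟨?_, ?_, ?_, ?_, ?_⟩, ?_⟩))))
    · exact (((hG'.congr hs).setVar (by norm_num) _).setVar (by norm_num) _).setVar (by norm_num) _
    · simp [e4, h4]
    · simp [e5]; omega
    · simpa [e1, e4, e5, e6, e7, h4, hG'.size] using hstep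
    · simp only [State.setVar_var, Nat.reduceEqDiff, if_false, if_true, Expr.eval, e5, Expr.cost]
      rw [Nat.succ_mul]
      omega
    · simp [e5]; omega
  · rintro s' t ⟨t', ⟨hG', h4, hle, hR, ht⟩, hb, rfl⟩
    have h5' : s'.var 5 = n := by
      simp [hG'.size] at hb
      omega
    rw [h5'] at hR ht
    exact ⟨hG'.size, hR.hasThreshold_iff, by simp; omega⟩

/-- The graph traversal algorithm. -/
def traversalProg : Prog :=
  ite (le (var 2) (const 1)) (assign 0 (const 1))
    (seq thresholdProg (ite (le (var 1) (var 4)) (assign 0 (const 1))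
      (seq searchProg
        (assign 0 (sub (le (var 7) (var 6)) (le (add (var 1) (const 2)) (var 7)))))))

theorem hasThreshold_of_card_le {V : Type*} [Fintype V] (G : SimpleGraph V) {h : ℕ}
    (hh : Fintype.card V ≤ h) : HasThreshold G h :=
  ⟨0, fun _ => ⟨((Set.ncard_le_card _).trans_eq Nat.card_eq_fintype_card).trans hh,
    Nat.le_add_left_of_le hh⟩⟩

theorem holdsGraph_inputState (G : SimpleGraph (Fin n)) (k z : ℕ) :
    HoldsGraph G (inputState G k z) where
  size := by simp [inputState]
  start j hj := by simp [inputState, hj, adjStart]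
  adj q := by simp [inputState]

theorem run_traversalProg (G : SimpleGraph (Fin n)) (k z : ℕ) :
    Run traversalProg (inputState G k z) fun s' t =>
      (s'.var 0 = 1 ↔ k ≤ 1 ∨ HasThreshold G (min n (z / 2))) ∧
      t ≤ 1000 * (n * (G.edgeSet.ncard + n) + 1) := by
  have e1 : (inputState G k z).var 1 = n := by simp [inputState]
  have e2 : (inputState G k z).var 2 = k := by simp [inputState]
  have e3 : (inputState G k z).var 3 = z := by simp [inputState]
  have e4 : (inputState G k z).var 4 = 0 := by simp [inputState]
  have e5 : (inputState G k z).var 5 = 0 := by simp [inputState]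
  have hn : n ≤ n * (G.edgeSet.ncard + n) := by
    rcases n.eq_zero_or_pos with rfl | hn
    · simp
    · exact Nat.le_mul_of_pos_right n (by omega)
  refine .ite (fun hk => .assign ⟨?_, ?_⟩) fun hk => .seq ((run_thresholdProg e4).mono ?_)
  · have hk : k ≤ 1 := by
      by_contra h
      simp [e2, h] at hk
    simp [hk]
  · simp; omega
  have hk : ¬ k ≤ 1 := by
    intro h
    simp [e2, h] at hk
  rintro _ t ⟨rfl, ht⟩
  rw [e1, e3]
  rw [e1] at ht
  set h := min n (z / 2) with hh
  refine .ite (fun hb => .assign ⟨?_, ?_⟩) fun hb =>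
    .seq ((run_searchProg ((holdsGraph_inputState G k z).setVar (by norm_num) _)
      (by simpa using e5) (by simpa [e1] using hb)).mono ?_)
  · have hnh : n ≤ h := by
      by_contra h'
      simp [e1, h'] at hb
    simpa using Or.inr (hasThreshold_of_card_le G (by simpa using hnh))
  · simp; omega
  · rintro s' t' ⟨e1', hiff, ht'⟩
    refine .assign ⟨?_, ?_⟩
    · rw [State.setVar_var, if_pos rfl] at hiff
      simp only [hk, false_or, hiff, State.setVar_var, if_true, Expr.eval, e1']
      by_cases hA : s'.var 7 ≤ s'.var 6 <;> by_cases hB : n + 2 ≤ s'.var 7 <;> simp [hA, hB]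
      omega
    · have : n * (200 * (G.edgeSet.ncard + n) + 150) =
          200 * (n * (G.edgeSet.ncard + n)) + 150 * n := by ring
      simp
      omega

theorem traversalProg_haltsWithin (G : SimpleGraph (Fin n)) (k z : ℕ) :
    traversalProg.HaltsWithin (inputState G k z) (1000 * (n * (G.edgeSet.ncard + n) + 1)) := by
  obtain ⟨s', t, he, -, ht⟩ := run_traversalProg G k z
  exact ⟨s', t, he, ht⟩

theorem traversalProg_accepts_iff (G : SimpleGraph (Fin n)) (k z : ℕ) :
    traversalProg.Accepts (inputState G k z) ↔ k ≤ 1 ∨ HasThreshold G (min n (z / 2)) := by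
  obtain ⟨s', t, he, hiff, -⟩ := run_traversalProg G k z
  rw [← hiff]
  constructor
  · rintro ⟨s'', t', he', h⟩
    rwa [(he.unique he').1]
  · exact fun h => ⟨s', t, he, h⟩

end Decision

/-! ### Independence of the edges of the random graph. -/

section EdgeIndependence

open MeasureTheory ProbabilityTheory

variable {V : Type*} [Fintype V]

instance : DiscreteMeasurableSpace (SimpleGraph V) where
  forall_measurableSet S := by
    have h : MeasurableSet (SimpleGraph.edgeSet '' S) := MeasurableSet.of_discrete
    have := SimpleGraph.measurableEmbedding_edgeSet.measurable h
    rwa [Set.preimage_image_eq _ SimpleGraph.edgeSet_injective] at this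

/-- The law of the indicator of the edge `e`. -/
noncomputable def edgeLaw (p : unitInterval) (e : Sym2 V) : Measure Prop :=
  unitInterval.toNNReal p • Measure.dirac (e ∈ (Sym2.diagSet : Set (Sym2 V))ᶜ) +
    unitInterval.toNNReal (unitInterval.symm p) • Measure.dirac False

omit [Fintype V] in
instance (p : unitInterval) (e : Sym2 V) : IsProbabilityMeasure (edgeLaw p e) := by
  unfold edgeLaw; infer_instance

/-- This exhibits the random graph as an image of a product measure, where independence of the
coordinates is available. -/
theorem binomialRandom_eq_map_infinitePi (p : unitInterval) :
    SimpleGraph.binomialRandom V p = (Measure.infinitePi (edgeLaw (V := V) p)).map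
      fun ω => SimpleGraph.fromEdgeSet {e | ω e} := by
  rw [SimpleGraph.binomialRandom_eq_map, setBernoulli_eq_map,
    Measure.map_map .of_discrete .of_discrete]
  rfl

theorem iIndepFun_mem_edgeSet (p : unitInterval) :
    iIndepFun (fun (e : Sym2 V) (G : SimpleGraph V) => e ∈ G.edgeSet)
      (SimpleGraph.binomialRandom V p) := by
  classical
  have h : iIndepFun (fun (e : Sym2 V) (ω : Sym2 V → Prop) => ω e ∧ ¬ e.IsDiag)
      (Measure.infinitePi (edgeLaw (V := V) p)) :=
    iIndepFun_infinitePi (X := fun (e : Sym2 V) (q : Prop) => q ∧ ¬ e.IsDiag) fun e => .of_discrete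
  rw [iIndepFun_iff_map_fun_eq_pi_map fun e => Measurable.of_discrete.aemeasurable] at h ⊢
  rw [binomialRandom_eq_map_infinitePi, Measure.map_map .of_discrete .of_discrete]
  simp only [Measure.map_map (Measurable.of_discrete (α := SimpleGraph V)) (Measurable.of_discrete (α := Sym2 V → Prop))]
  have hmem : ∀ (e : Sym2 V) (ω : Sym2 V → Prop),
      e ∈ (SimpleGraph.fromEdgeSet {e | ω e}).edgeSet ↔ ω e ∧ ¬ e.IsDiag := by
    intro e ω
    simp
  simpa only [Function.comp_def, hmem] using h

/-- The random variable `f` depends only on the edges in `S`. -/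
def EdgeDetermined {β : Type*} (S : Set (Sym2 V)) (f : SimpleGraph V → β) : Prop :=
  ∀ G H : SimpleGraph V, (∀ e ∈ S, e ∈ G.edgeSet ↔ e ∈ H.edgeSet) → f G = f H

/-- Each function factors through the restriction of the edge indicators to its own set, and
restrictions to disjoint sets are independent. -/
theorem integral_mul_of_edgeDetermined (p : unitInterval) {S T : Set (Sym2 V)}
    (hST : Disjoint S T) {f g : SimpleGraph V → ℝ} (hf : EdgeDetermined S f)
    (hg : EdgeDetermined T g) :
    ∫ G, f G * g G ∂SimpleGraph.binomialRandom V p =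
      (∫ G, f G ∂SimpleGraph.binomialRandom V p) * ∫ G, g G ∂SimpleGraph.binomialRandom V p := by
  classical
  have hind := (iIndepFun_mem_edgeSet p).indepFun_finset S.toFinset T.toFinset
    (by simpa using hST) (fun i => .of_discrete)
  have hfac : ∀ (S : Set (Sym2 V)) (f : SimpleGraph V → ℝ), EdgeDetermined S f →
      ∃ φ : (S.toFinset → Prop) → ℝ, f = φ ∘ fun G e => (e : Sym2 V) ∈ G.edgeSet := by
    intro S f hf
    refine ⟨Function.extend (fun (G : SimpleGraph V) (e : S.toFinset) => (e : Sym2 V) ∈ G.edgeSet)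
      f 0, ?_⟩
    have : Function.FactorsThrough f
        (fun (G : SimpleGraph V) (e : S.toFinset) => (e : Sym2 V) ∈ G.edgeSet) := by
      intro G H hGH
      exact hf G H fun e he => iff_of_eq (congrFun hGH ⟨e, by simpa using he⟩)
    funext G
    exact (this.extend_apply 0 G).symm
  obtain ⟨φ, hφ⟩ := hfac S f hf
  obtain ⟨ψ, hψ⟩ := hfac T g hg
  have hfg : f ⟂ᵢ[SimpleGraph.binomialRandom V p] g := by
    rw [hφ, hψ]
    exact hind.comp (Measurable.of_discrete) (Measurable.of_discrete)
  exact hfg.integral_fun_mul_eq_mul_integral (Measurable.of_discrete).aestronglyMeasurable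
    (Measurable.of_discrete).aestronglyMeasurable

omit [Fintype V] in
theorem EdgeDetermined.mono {β : Type*} {S T : Set (Sym2 V)} {f : SimpleGraph V → β}
    (hf : EdgeDetermined S f) (hST : S ⊆ T) : EdgeDetermined T f :=
  fun G H h => hf G H fun e he => h e (hST he)

theorem integral_prod_of_edgeDetermined (p : unitInterval) {ι : Type*} [DecidableEq ι]
    (W : Finset ι)
    {T : ι → Set (Sym2 V)} (hT : ∀ w ∈ W, ∀ x ∈ W, w ≠ x → Disjoint (T w) (T x))
    {f : ι → SimpleGraph V → ℝ} (hf : ∀ w ∈ W, EdgeDetermined (T w) (f w)) :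
    ∫ G, ∏ w ∈ W, f w G ∂SimpleGraph.binomialRandom V p =
      ∏ w ∈ W, ∫ G, f w G ∂SimpleGraph.binomialRandom V p := by
  induction W using Finset.induction_on with
  | empty => simp
  | insert a W ha ih =>
    simp only [Finset.prod_insert ha]
    rw [integral_mul_of_edgeDetermined p (S := T a) (T := ⋃ w ∈ W, T w), ih]
    · exact fun w hw x hx => hT w (Finset.mem_insert_of_mem hw) x (Finset.mem_insert_of_mem hx)
    · exact fun w hw => hf w (Finset.mem_insert_of_mem hw)
    · rw [Set.disjoint_iUnion₂_right]
      exact fun w hw => hT a (Finset.mem_insert_self a W) w (Finset.mem_insert_of_mem hw)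
        fun h => ha (h ▸ hw)
    · exact hf a (Finset.mem_insert_self a W)
    · intro G H h
      exact Finset.prod_congr rfl fun w hw => hf w (Finset.mem_insert_of_mem hw) G H
        fun e he => h e (Set.mem_biUnion hw he)

open scoped Classical in
theorem integral_not_adj (p : unitInterval) {a b : V} (hab : a ≠ b) :
    ∫ G : SimpleGraph V, (if G.Adj a b then (0 : ℝ) else 1) ∂SimpleGraph.binomialRandom V p =
      1 - p := by
  have hadj : ∀ ω : Sym2 V → Prop,
      (SimpleGraph.fromEdgeSet {e | ω e}).Adj a b ↔ ω s(a, b) := by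
    intro ω
    simp [hab]
  have hdiag : s(a, b) ∈ (Sym2.diagSet : Set (Sym2 V))ᶜ := by simpa using hab
  rw [binomialRandom_eq_map_infinitePi, integral_map Measurable.of_discrete.aemeasurable
    Measurable.of_discrete.aestronglyMeasurable]
  simp only [hadj]
  rw [← integral_map (μ := Measure.infinitePi (edgeLaw (V := V) p)) (φ := fun ω => ω s(a, b))
    (f := fun q : Prop => if q then (0 : ℝ) else 1) Measurable.of_discrete.aemeasurable
    Measurable.of_discrete.aestronglyMeasurable]
  have := Measure.infinitePi_map_eval (edgeLaw (V := V) p) s(a, b)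
  rw [show (fun ω : Sym2 V → Prop => ω s(a, b)) = Function.eval s(a, b) from rfl, this, edgeLaw,
    integral_add_measure .of_finite .of_finite, integral_smul_nnreal_measure,
    integral_smul_nnreal_measure, integral_dirac, integral_dirac]
  simp [hdiag, NNReal.smul_def]

end EdgeIndependence

/-! ### Exploring the random graph layer by layer. -/

section Exploration

open MeasureTheory ProbabilityTheory

open scoped Classical in
/-- The vertices at distance less than `j` from `v`. -/
noncomputable def reached {V : Type*} [Fintype V] (G : SimpleGraph V) (v : V) : ℕ → Finset V
  | 0 => ∅
  | j + 1 => Finset.univ.filter fun w => w ∈ iterNbhd G j v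

open scoped Classical in
/-- The vertices at distance `j` from `v`. -/
noncomputable def layer {V : Type*} [Fintype V] (G : SimpleGraph V) (v : V) (j : ℕ) :
    Finset V :=
  reached G v (j + 1) \ reached G v j

variable {V : Type*} [Fintype V] (G H : SimpleGraph V) (v : V)

theorem mem_reached_succ {j : ℕ} {w : V} : w ∈ reached G v (j + 1) ↔ w ∈ iterNbhd G j v := by
  simp [reached]

theorem card_reached_succ (j : ℕ) : (reached G v (j + 1)).card = (iterNbhd G j v).ncard := by
  rw [← Set.ncard_coe_finset]
  congr 1
  ext w
  simp [mem_reached_succ]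

theorem mem_reached_add_two {j : ℕ} {w : V} :
    w ∈ reached G v (j + 2) ↔ ∃ s ∈ reached G v (j + 1), w = s ∨ G.Adj s w := by
  simp [mem_reached_succ, iterNbhd]

theorem reached_subset_succ (j : ℕ) : reached G v j ⊆ reached G v (j + 1) := by
  intro w hw
  rcases j with _ | j
  · simp [reached] at hw
  · exact (mem_reached_add_two G v).2 ⟨w, hw, Or.inl rfl⟩

theorem mem_layer {j : ℕ} {w : V} :
    w ∈ layer G v j ↔ w ∈ reached G v (j + 1) ∧ w ∉ reached G v j := by
  classical
  simp [layer]

theorem mem_reached_iff_layer {j : ℕ} {w : V} (hw : w ∉ reached G v (j + 1)) :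
    w ∈ reached G v (j + 2) ↔ ∃ b ∈ layer G v j, G.Adj b w := by
  rw [mem_reached_add_two]
  constructor
  · rintro ⟨s, hs, rfl | hsw⟩
    · exact absurd hs hw
    · refine ⟨s, (mem_layer G v).2 ⟨hs, fun hs' => hw ?_⟩, hsw⟩
      rcases j with _ | j
      · simp [reached] at hs'
      · exact (mem_reached_add_two G v).2 ⟨s, hs', Or.inr hsw⟩
  · rintro ⟨b, hb, hbw⟩
    exact ⟨b, ((mem_layer G v).1 hb).1, Or.inr hbw⟩

theorem card_layer_add (j : ℕ) :
    (layer G v j).card + (reached G v j).card = (reached G v (j + 1)).card := by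
  classical
  exact Finset.card_sdiff_add_card_eq_card (reached_subset_succ G v j)

/-- The edges that touch the set `A`. -/
def touching (A : Finset V) : Set (Sym2 V) := {e | ∃ a ∈ A, a ∈ e}

theorem reached_mono {i j : ℕ} (hij : i ≤ j) : reached G v i ⊆ reached G v j := by
  induction hij with
  | refl => exact subset_rfl
  | step _ ih => exact ih.trans (reached_subset_succ G v _)

theorem reached_congr {j : ℕ}
    (h : ∀ e ∈ touching (reached G v j), e ∈ G.edgeSet ↔ e ∈ H.edgeSet) :
    ∀ l ≤ j + 1, reached G v l = reached H v l := by
  intro l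
  induction l with
  | zero => exact fun _ => rfl
  | succ l ih =>
    intro hl
    have ih := ih (by omega)
    rcases l with _ | l
    · rfl
    ext w
    rw [mem_reached_add_two, mem_reached_add_two, ← ih]
    refine exists_congr fun s => and_congr_right fun hs => or_congr_right ?_
    exact h s(s, w) ⟨s, reached_mono G v (by omega) hs, by simp⟩

open scoped Classical in
-- If the vertices at distance less than j are A, then the next set consists of A and its neighbors
-- (or is the root, if j = 0), so no edge away from A has been inspected.
theorem edgeDetermined_reached (j : ℕ) (A A' : Finset V) :
    EdgeDetermined (touching A) fun G =>
      if reached G v j = A ∧ reached G v (j + 1) = A' then (1 : ℝ) else 0 := by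
  suffices h : ∀ G H : SimpleGraph V, (∀ e ∈ touching A, e ∈ G.edgeSet ↔ e ∈ H.edgeSet) →
      reached G v j = A ∧ reached G v (j + 1) = A' →
        reached H v j = A ∧ reached H v (j + 1) = A' by
    intro G H hGH
    have : (reached G v j = A ∧ reached G v (j + 1) = A') ↔
        (reached H v j = A ∧ reached H v (j + 1) = A') :=
      ⟨h G H hGH, h H G fun e he => (hGH e he).symm⟩
    simp only [this]
  rintro G H hGH ⟨rfl, rfl⟩
  have := reached_congr G H v hGH
  exact ⟨(this j (by omega)).symm, (this (j + 1) le_rfl).symm⟩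

open scoped Classical in
-- The integrand is exp θ - (exp θ - 1) ∏ (1 - 1[b ~ w]), a product over distinct edges.
theorem integral_exists_adj (p : unitInterval) (θ : ℝ) {B : Finset V} {w : V} (hw : w ∉ B) :
    ∫ G : SimpleGraph V, (if ∃ b ∈ B, G.Adj b w then Real.exp θ else 1)
        ∂SimpleGraph.binomialRandom V p =
      Real.exp θ - (Real.exp θ - 1) * (1 - (p : ℝ)) ^ B.card := by
  have hrw : ∀ G : SimpleGraph V, (if ∃ b ∈ B, G.Adj b w then Real.exp θ else 1) =
      Real.exp θ - (Real.exp θ - 1) * ∏ b ∈ B, if G.Adj b w then (0 : ℝ) else 1 := by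
    intro G
    by_cases h : ∃ b ∈ B, G.Adj b w
    · obtain ⟨b, hb, hbw⟩ := h
      have h0 : ∏ b ∈ B, (if G.Adj b w then (0 : ℝ) else 1) = 0 :=
        Finset.prod_eq_zero hb (if_pos hbw)
      rw [if_pos ⟨b, hb, hbw⟩, h0]
      ring
    · rw [if_neg h, Finset.prod_eq_one fun b hb => if_neg fun hbw => h ⟨b, hb, hbw⟩]
      ring
  simp only [hrw]
  rw [integral_sub .of_finite .of_finite, integral_const_mul,
    integral_prod_of_edgeDetermined p B (T := fun b => {s(b, w)})]
  · rw [Finset.prod_congr rfl fun b hb => integral_not_adj p (a := b) (b := w)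
      (ne_of_mem_of_not_mem hb hw)]
    simp
  · intro a _ b _ hab
    rw [Set.disjoint_singleton]
    exact fun h => hab (Sym2.congr_left.1 h)
  · intro b _ G H h
    have : G.Adj b w ↔ H.Adj b w := h s(b, w) rfl
    simp only [this]

open scoped Classical in
theorem exp_card_layer_succ (θ : ℝ) (j : ℕ) :
    Real.exp (θ * (layer G v (j + 1)).card) =
      ∏ w ∈ (reached G v (j + 1))ᶜ,
        if ∃ b ∈ layer G v j, G.Adj b w then Real.exp θ else 1 := by
  rw [mul_comm, Real.exp_nat_mul, Finset.prod_ite, Finset.prod_const_one, mul_one,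
    Finset.prod_const]
  congr 2
  ext w
  rw [layer, Finset.mem_sdiff, Finset.mem_filter, Finset.mem_compl, and_comm]
  exact and_congr_right fun hw => mem_reached_iff_layer G v hw

open scoped Classical in
/-- The next step of the exploration of the random graph from `v` is independent of the past. -/
theorem integral_exploration_step (p : unitInterval) (θ : ℝ) (j : ℕ)
    (h : Finset V → Finset V → ℝ) :
    ∫ G, h (reached G v j) (reached G v (j + 1)) * Real.exp (θ * (layer G v (j + 1)).card)
        ∂SimpleGraph.binomialRandom V p =
      ∫ G, h (reached G v j) (reached G v (j + 1)) *
        (Real.exp θ - (Real.exp θ - 1) * (1 - (p : ℝ)) ^ (layer G v j).card) ^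
          (Fintype.card V - (reached G v (j + 1)).card) ∂SimpleGraph.binomialRandom V p := by
  set μ := SimpleGraph.binomialRandom V p
  let ind : Finset V × Finset V → SimpleGraph V → ℝ := fun A G =>
    if reached G v j = A.1 ∧ reached G v (j + 1) = A.2 then 1 else 0
  -- Split according to the values (A, A') of the two consecutive sets, so that the random sets
  -- become constants in each summand.
  have expand : ∀ (F : Finset V × Finset V → SimpleGraph V → ℝ) (G : SimpleGraph V),
      F (reached G v j, reached G v (j + 1)) G = ∑ A, ind A G * F A G := by
    intro F G
    rw [Finset.sum_eq_single (reached G v j, reached G v (j + 1))]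
    · simp [ind]
    · intro A _ hA
      have : ¬ (reached G v j = A.1 ∧ reached G v (j + 1) = A.2) := fun h => hA (by
        rw [h.1, h.2])
      simp [ind, this]
    · simp
  -- The past depends on edges touching A, the next layer on edges from A' \ A to the complement of
  -- A'. These do not meet, and distinct outside vertices w use disjoint edges.
  have key : ∀ A : Finset V × Finset V,
      ∫ G, ind A G * ∏ w ∈ A.2ᶜ, (if ∃ b ∈ A.2 \ A.1, G.Adj b w then Real.exp θ else 1) ∂μ =
        ∫ G, ind A G * (Real.exp θ - (Real.exp θ - 1) * (1 - (p : ℝ)) ^ (A.2 \ A.1).card) ^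
          (Fintype.card V - A.2.card) ∂μ := by
    rintro ⟨A, A'⟩
    by_cases hA : A ⊆ A'
    swap
    · have : ∀ G, ind (A, A') G = 0 := fun G => by
        refine if_neg ?_
        rintro ⟨rfl, rfl⟩
        exact hA (reached_subset_succ G v j)
      simp [this]
    have hw : ∀ w ∈ A'ᶜ, w ∉ A' \ A := fun w hw h =>
      Finset.mem_compl.1 hw (Finset.mem_sdiff.1 h).1
    have hdet : ∀ w ∈ A'ᶜ, EdgeDetermined {e | ∃ b ∈ A' \ A, e = s(b, w)}
        fun G : SimpleGraph V => if ∃ b ∈ A' \ A, G.Adj b w then Real.exp θ else 1 := by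
      intro w _ G H hGH
      have : (∃ b ∈ A' \ A, G.Adj b w) ↔ ∃ b ∈ A' \ A, H.Adj b w :=
        exists_congr fun b => and_congr_right fun hb => hGH s(b, w) ⟨b, hb, rfl⟩
      simp only [this]
    rw [integral_mul_of_edgeDetermined p (S := touching A)
      (T := ⋃ w ∈ A'ᶜ, {e | ∃ b ∈ A' \ A, e = s(b, w)}) ?_ (edgeDetermined_reached v j A A'),
      integral_prod_of_edgeDetermined p _ ?_ hdet, integral_mul_const,
      Finset.prod_congr rfl fun w hw' => integral_exists_adj p θ (B := A' \ A) (w := w) (hw w hw'), Finset.prod_const,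
      Finset.card_compl]
    · rintro w hw x hx hwx
      rw [Set.disjoint_left]
      rintro e ⟨b, hb, rfl⟩ ⟨c, hc, he⟩
      rcases Sym2.eq_iff.1 he with ⟨-, h⟩ | ⟨h, -⟩
      · exact hwx h
      · exact Finset.mem_compl.1 hx (h ▸ (Finset.mem_sdiff.1 hb).1)
    · intro G H hGH
      exact Finset.prod_congr rfl fun w hw => hdet w hw G H fun e he =>
        hGH e (Set.mem_biUnion (by exact hw) he)
    · rw [Set.disjoint_iUnion₂_right]
      intro w hw
      rw [Set.disjoint_left]
      rintro _ ⟨a, ha, hae⟩ ⟨b, hb, rfl⟩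
      rcases Sym2.mem_iff.1 hae with rfl | rfl
      · exact (Finset.mem_sdiff.1 hb).2 ha
      · exact Finset.mem_compl.1 hw (hA ha)
  have e₁ : ∀ G, h (reached G v j) (reached G v (j + 1)) *
      Real.exp (θ * (layer G v (j + 1)).card) =
      ∑ A, h A.1 A.2 * (ind A G *
        ∏ w ∈ A.2ᶜ, (if ∃ b ∈ A.2 \ A.1, G.Adj b w then Real.exp θ else 1)) := by
    intro G
    rw [exp_card_layer_succ]
    refine (expand (fun A G => h A.1 A.2 *
      ∏ w ∈ A.2ᶜ, (if ∃ b ∈ A.2 \ A.1, G.Adj b w then Real.exp θ else 1)) G).trans ?_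
    exact Finset.sum_congr rfl fun A _ => mul_left_comm _ _ _
  have e₂ : ∀ G, h (reached G v j) (reached G v (j + 1)) *
      (Real.exp θ - (Real.exp θ - 1) * (1 - (p : ℝ)) ^ (layer G v j).card) ^
          (Fintype.card V - (reached G v (j + 1)).card) =
      ∑ A, h A.1 A.2 * (ind A G *
        (Real.exp θ - (Real.exp θ - 1) * (1 - (p : ℝ)) ^ (A.2 \ A.1).card) ^
          (Fintype.card V - A.2.card)) := by
    intro G
    refine (expand (fun A G => h A.1 A.2 *
      (Real.exp θ - (Real.exp θ - 1) * (1 - (p : ℝ)) ^ (A.2 \ A.1).card) ^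
          (Fintype.card V - A.2.card)) G).trans ?_
    exact Finset.sum_congr rfl fun A _ => mul_left_comm _ _ _
  simp only [e₁, e₂]
  rw [integral_finsetSum _ fun _ _ => .of_finite, integral_finsetSum _ fun _ _ => .of_finite]
  refine Finset.sum_congr rfl fun A _ => ?_
  rw [integral_const_mul, integral_const_mul, key]

end Exploration

/-! ### Tail bounds for balls, layers and missed vertices. -/

section Tails

open MeasureTheory ProbabilityTheory

variable {V : Type*} [Fintype V]

theorem one_sub_pow_le {p : ℝ} (h1 : p ≤ 1) (f : ℕ) :
    (1 - p) ^ f ≤ Real.exp (-(p * f)) := by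
  have h : 1 - p ≤ Real.exp (-p) := by linarith [Real.add_one_le_exp (-p)]
  calc (1 - p) ^ f ≤ Real.exp (-p) ^ f := pow_le_pow_left₀ (by linarith) h f
    _ = Real.exp (-(p * f)) := by rw [← Real.exp_nat_mul]; ring_nf

theorem exp_neg_le_inv {x : ℝ} (hx : 0 ≤ x) : Real.exp (-x) ≤ 1 / (1 + x) := by
  rw [Real.exp_neg, ← one_div]
  exact one_div_le_one_div_of_le (by linarith) (by linarith [Real.add_one_le_exp x])

theorem card_reached_one (G : SimpleGraph V) (v : V) : (reached G v 1).card = 1 := by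
  rw [card_reached_succ]
  simp [iterNbhd]

theorem card_layer_zero (G : SimpleGraph V) (v : V) : (layer G v 0).card = 1 := by
  have := card_layer_add G v 0
  rwa [zero_add, card_reached_one, reached, Finset.card_empty, add_zero] at this

theorem measureReal_le_integral (μ : Measure (SimpleGraph V)) [IsProbabilityMeasure μ]
    {S : Set (SimpleGraph V)} {X : SimpleGraph V → ℝ} (h₀ : ∀ G, 0 ≤ X G)
    (h₁ : ∀ G ∈ S, 1 ≤ X G) : μ.real S ≤ ∫ G, X G ∂μ := by
  rw [← integral_indicator_one .of_discrete]
  refine integral_mono .of_finite .of_finite fun G => ?_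
  by_cases hG : G ∈ S
  · simpa [hG] using h₁ G hG
  · simpa [hG] using h₀ G

/-- Given the past, an outside vertex joins with probability at most pf by Bernoulli's inequality,
where f is the size of the last layer; then f is bounded by the whole ball. -/
theorem integral_exp_card_reached_step (p : unitInterval) (v : V) {θ : ℝ} (hθ : 0 ≤ θ) (j : ℕ) :
    ∫ G, Real.exp (θ * (reached G v (j + 2)).card) ∂SimpleGraph.binomialRandom V p ≤
      ∫ G, Real.exp ((θ + Fintype.card V * p * (Real.exp θ - 1)) * (reached G v (j + 1)).card)
        ∂SimpleGraph.binomialRandom V p := by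
  have h := integral_exploration_step v p θ j fun _ A' => Real.exp (θ * A'.card)
  have e : ∀ G : SimpleGraph V, Real.exp (θ * (reached G v (j + 2)).card) =
      Real.exp (θ * (reached G v (j + 1)).card) * Real.exp (θ * (layer G v (j + 1)).card) := by
    intro G
    rw [← Real.exp_add, ← mul_add, ← card_layer_add]
    push_cast
    ring_nf
  simp only [e]
  rw [h]
  refine integral_mono .of_finite .of_finite fun G => ?_
  simp only
  rw [add_mul, Real.exp_add]
  refine mul_le_mul_of_nonneg_left ?_ (Real.exp_pos _).le
  set f := (layer G v j).card
  set r := (reached G v (j + 1)).card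
  have hfr : f ≤ r := by have := card_layer_add G v j; omega
  have he : 0 ≤ Real.exp θ - 1 := by linarith [Real.one_le_exp hθ]
  have hp0 : (0 : ℝ) ≤ p := p.2.1
  have hp1 : (p : ℝ) ≤ 1 := p.2.2
  have hb : 1 - f * (p : ℝ) ≤ (1 - (p : ℝ)) ^ f := by
    have := one_add_mul_le_pow (a := -(p : ℝ)) (by linarith) f
    rw [← sub_eq_add_neg] at this
    linarith
  have hq : (1 - (p : ℝ)) ^ f ≤ 1 := pow_le_one₀ (by linarith) (by linarith)
  have h1 : Real.exp θ - (Real.exp θ - 1) * (1 - (p : ℝ)) ^ f ≤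
      Real.exp ((Real.exp θ - 1) * (p * f)) := by
    refine le_trans ?_ (Real.add_one_le_exp _)
    nlinarith
  have h0 : 0 ≤ Real.exp θ - (Real.exp θ - 1) * (1 - (p : ℝ)) ^ f := by nlinarith
  refine (pow_le_pow_left₀ h0 h1 _).trans ?_
  rw [← Real.exp_nat_mul, Real.exp_le_exp]
  have h2 : ((Fintype.card V - r : ℕ) : ℝ) ≤ Fintype.card V := by exact_mod_cast Nat.sub_le _ _
  have h3 : (f : ℝ) ≤ r := by exact_mod_cast hfr
  calc ((Fintype.card V - r : ℕ) : ℝ) * ((Real.exp θ - 1) * (p * f))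
      ≤ Fintype.card V * ((Real.exp θ - 1) * (p * r)) := by gcongr
    _ = Fintype.card V * p * (Real.exp θ - 1) * r := by ring

/-- The scales for the upper tails of the exploration. -/
noncomputable def upperScale (m : ℝ) : ℕ → ℝ
  | 0 => 1 / m
  | j + 1 => m * upperScale m j + 1

theorem upperScale_pos {m : ℝ} (hm : 0 < m) (j : ℕ) : 0 < upperScale m j := by
  induction j with
  | zero => exact one_div_pos.2 hm
  | succ j ih => unfold upperScale; positivity

theorem upperScale_mul_le {m : ℝ} (hm : 2 ≤ m) (j : ℕ) : upperScale m j * m ≤ 3 * m ^ j - 2 := by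
  induction j with
  | zero => simp only [upperScale]; rw [one_div_mul_cancel (by linarith)]; norm_num
  | succ j ih => simp only [upperScale, pow_succ]; nlinarith

/-- The scales φ solve the recursion: with m = np + 1 and θ = 1/(mφ_j + 1), the bound exp θ ≤ 1/(1 -
θ) gives θ + np(exp θ - 1) ≤ m(exp θ - 1) ≤ 1/φ_j. The start φ_0 = 1/m makes the initial moment exp
m. -/
theorem integral_exp_card_reached_le (p : unitInterval) (v : V) (j : ℕ) :
    ∫ G, Real.exp (1 / upperScale (Fintype.card V * p + 1) j * (reached G v (j + 1)).card)
      ∂SimpleGraph.binomialRandom V p ≤ Real.exp (Fintype.card V * p + 1) := by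
  set m := Fintype.card V * (p : ℝ) + 1
  have hnp : 0 ≤ Fintype.card V * (p : ℝ) := mul_nonneg (Nat.cast_nonneg _) p.2.1
  have hm : 0 < m := by simp only [m]; linarith
  induction j with
  | zero => simp [card_reached_one, upperScale]
  | succ j ih =>
    have hφ := upperScale_pos hm j
    have hφ' : 0 < 1 / upperScale m (j + 1) := one_div_pos.2 (upperScale_pos hm _)
    refine (integral_exp_card_reached_step p v hφ'.le j).trans (le_trans ?_ ih)
    refine integral_mono .of_finite .of_finite fun G => ?_
    simp only
    rw [Real.exp_le_exp]
    refine mul_le_mul_of_nonneg_right ?_ (Nat.cast_nonneg _)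
    set θ := 1 / upperScale m (j + 1) with hθ
    have h1 : θ * (m * upperScale m j + 1) = 1 := by
      rw [hθ]; exact one_div_mul_cancel (upperScale_pos hm (j + 1)).ne'
    have hθ1 : 0 < 1 - θ := by
      have : 0 < θ * (m * upperScale m j) := by positivity
      linarith
    have h2 : Real.exp θ * (1 - θ) ≤ 1 := by
      have := Real.one_sub_le_exp_neg θ
      calc Real.exp θ * (1 - θ) ≤ Real.exp θ * Real.exp (-θ) := by gcongr
        _ = 1 := by rw [← Real.exp_add]; simp
    have h3 : θ ≤ Real.exp θ - 1 := by linarith [Real.add_one_le_exp θ]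
    have h4 : m * (Real.exp θ - 1) ≤ 1 / upperScale m j := by
      rw [le_div_iff₀ hφ]
      have h5 : (1 - θ) = θ * (m * upperScale m j) := by linarith
      have h6 : (Real.exp θ - 1) * (1 - θ) ≤ θ := by linarith
      rw [h5] at h6
      have : θ * ((Real.exp θ - 1) * (m * upperScale m j)) ≤ θ * 1 := by linarith
      have := le_of_mul_le_mul_left this hφ'
      linarith
    refine le_trans ?_ h4
    simp only [m]
    linarith

/-- The balls of the random graph are not much larger than expected. -/
theorem measureReal_le_card_reached (p : unitInterval) (v : V) (j : ℕ)
    (hp : 1 ≤ Fintype.card V * (p : ℝ)) :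
    (SimpleGraph.binomialRandom V p).real
      {G | 9 * (Fintype.card V * (p : ℝ) + 1) ^ j ≤ (reached G v (j + 1)).card} ≤
      Real.exp (-(2 * (Fintype.card V * (p : ℝ) + 1))) := by
  set m := Fintype.card V * (p : ℝ) + 1 with hm_def
  have hm : 2 ≤ m := by simp only [m]; linarith
  have hφ := upperScale_pos (show 0 < m by linarith) j
  -- Markov's inequality: since φ_j m ≤ 3m^j, a ball of size 9m^j has exponent at least 3m, against
  -- a moment of exp m.
  refine (measureReal_le_integral _ (X := fun G => Real.exp (-(3 * m)) *
    Real.exp (1 / upperScale m j * (reached G v (j + 1)).card)) (fun G => by positivity)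
    fun G hG => ?_).trans ?_
  · rw [← Real.exp_add]
    refine Real.one_le_exp ?_
    have h1 : 9 * m ^ j ≤ ((reached G v (j + 1)).card : ℝ) := hG
    have h2 := upperScale_mul_le hm j
    have h3 : 3 * m ≤ 1 / upperScale m j * (reached G v (j + 1)).card := by
      rw [one_div_mul_eq_div, le_div_iff₀ hφ]
      linarith
    linarith
  · rw [integral_const_mul]
    refine (mul_le_mul_of_nonneg_left (integral_exp_card_reached_le p v j)
      (Real.exp_pos _).le).trans ?_
    rw [← Real.exp_add, Real.exp_le_exp]
    linarith

/-- Two losses of a factor 1 - pκ each combine to 1 - 2pκ: one from 1 - (1-p)^f ≥ pf(1 - pκ), where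
overlaps are discarded, and one from the vertices already used, n - r ≥ n - κ ≥ n(1 - pκ) because np
≥ 1. -/
theorem pow_le_exp_layer {n r f : ℕ} {p κ ν θ : ℝ} (hp0 : 0 ≤ p) (hp1 : p ≤ 1) (hnp : 1 ≤ n * p)
    (hfr : f ≤ r) (hrn : r ≤ n) (hrκ : r ≤ κ) (hκ : 2 * (p * κ) ≤ 1)
    (hν : ν ≤ n * p * (1 - 2 * (p * κ))) (hθ : 0 ≤ θ) :
    (Real.exp (-θ) - (Real.exp (-θ) - 1) * (1 - p) ^ f) ^ (n - r) ≤
      Real.exp (-(ν * θ / (1 + θ) * f)) := by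
  have hq0 : 0 ≤ (1 - p) ^ f := pow_nonneg (by linarith) f
  have hq1 : (1 - p) ^ f ≤ 1 := pow_le_one₀ (by linarith) (by linarith)
  have he1 : Real.exp (-θ) ≤ 1 := Real.exp_le_one_iff.2 (by linarith)
  have he0 := Real.exp_pos (-θ)
  have hr0 : (0 : ℝ) ≤ r := Nat.cast_nonneg r
  have hf0 : (0 : ℝ) ≤ f := Nat.cast_nonneg f
  have hfr' : (f : ℝ) ≤ r := by exact_mod_cast hfr
  have hκ0 : 0 ≤ κ := hr0.trans hrκ
  have hpκ : 0 ≤ p * κ := mul_nonneg hp0 hκ0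
  have h1 : Real.exp (-θ) - (Real.exp (-θ) - 1) * (1 - p) ^ f ≤
      Real.exp (-((1 - Real.exp (-θ)) * (1 - (1 - p) ^ f))) := by
    refine le_trans (le_of_eq ?_) (Real.add_one_le_exp _)
    ring
  have h0 : 0 ≤ Real.exp (-θ) - (Real.exp (-θ) - 1) * (1 - p) ^ f := by nlinarith
  refine (pow_le_pow_left₀ h0 h1 _).trans ?_
  rw [← Real.exp_nat_mul, Real.exp_le_exp, Nat.cast_sub hrn, mul_neg, neg_le_neg_iff]
  have hA : θ / (1 + θ) ≤ 1 - Real.exp (-θ) := by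
    have := exp_neg_le_inv hθ
    have h : θ / (1 + θ) = 1 - 1 / (1 + θ) := by field_simp; ring
    linarith
  have hA0 : 0 ≤ θ / (1 + θ) := by positivity
  have hx : 0 ≤ p * f := mul_nonneg hp0 hf0
  have hxκ : p * f ≤ p * κ := mul_le_mul_of_nonneg_left (hfr'.trans hrκ) hp0
  have hB : p * f * (1 - p * κ) ≤ 1 - (1 - p) ^ f := by
    have h2 := (one_sub_pow_le hp1 f).trans (exp_neg_le_inv hx)
    have h3 : p * f * (1 - p * f) ≤ 1 - 1 / (1 + p * f) := by
      have : 1 - 1 / (1 + p * f) = p * f / (1 + p * f) := by field_simp; ring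
      rw [this, le_div_iff₀ (by linarith)]
      nlinarith [mul_nonneg hx (mul_nonneg hx hx)]
    have h4 : p * f * (1 - p * κ) ≤ p * f * (1 - p * f) :=
      mul_le_mul_of_nonneg_left (by linarith) hx
    linarith
  have hκn : κ ≤ κ * (n * p) := le_mul_of_one_le_right hκ0 hnp
  have hn0 : (0 : ℝ) ≤ n := Nat.cast_nonneg n
  have hC : n * (1 - 2 * (p * κ)) ≤ (n - r) * (1 - p * κ) := by
    have : (n - κ) * (1 - p * κ) ≤ (n - r) * (1 - p * κ) :=
      mul_le_mul_of_nonneg_right (by linarith) (by linarith)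
    nlinarith [mul_nonneg hpκ hκ0]
  have hnr : (0 : ℝ) ≤ n - r := by
    have : (r : ℝ) ≤ n := by exact_mod_cast hrn
    linarith
  calc ν * θ / (1 + θ) * f = θ / (1 + θ) * (ν * f) := by ring
    _ ≤ θ / (1 + θ) * (n * p * (1 - 2 * (p * κ)) * f) := by gcongr
    _ = θ / (1 + θ) * ((n * (1 - 2 * (p * κ))) * (p * f)) := by ring
    _ ≤ θ / (1 + θ) * (((n - r) * (1 - p * κ)) * (p * f)) := by gcongr
    _ = (n - r) * (θ / (1 + θ) * (p * f * (1 - p * κ))) := by ring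
    _ ≤ (n - r) * ((1 - Real.exp (-θ)) * (1 - (1 - p) ^ f)) := by
      refine mul_le_mul_of_nonneg_left (mul_le_mul hA hB ?_ ?_) hnr
      · exact mul_nonneg hx (by linarith)
      · linarith

theorem integral_exp_neg_layer_step (p : unitInterval) (v : V) (j : ℕ) {κ ν θ : ℝ}
    (hnp : 1 ≤ Fintype.card V * (p : ℝ)) (hκ : 2 * (p * κ) ≤ 1)
    (hν : ν ≤ Fintype.card V * p * (1 - 2 * (p * κ))) (hθ : 0 ≤ θ) {g : Finset V → ℝ}
    (hg : ∀ A, 0 ≤ g A) :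
    ∫ G, g (reached G v j) * (if ((reached G v (j + 1)).card : ℝ) ≤ κ then 1 else 0) *
        Real.exp (-(θ * (layer G v (j + 1)).card)) ∂SimpleGraph.binomialRandom V p ≤
      ∫ G, g (reached G v j) * Real.exp (-(ν * θ / (1 + θ) * (layer G v j).card))
        ∂SimpleGraph.binomialRandom V p := by
  have h := integral_exploration_step v p (-θ) j
    fun A A' => g A * (if (A'.card : ℝ) ≤ κ then 1 else 0)
  simp only [neg_mul] at h
  rw [h]
  refine integral_mono .of_finite .of_finite fun G => ?_
  simp only
  by_cases hG : ((reached G v (j + 1)).card : ℝ) ≤ κ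
  · rw [if_pos hG, mul_one]
    refine mul_le_mul_of_nonneg_left (pow_le_exp_layer p.2.1 p.2.2 hnp ?_ (Finset.card_le_univ _)
      hG hκ hν hθ) (hg _)
    have := card_layer_add G v j
    omega
  · rw [if_neg hG, mul_zero, zero_mul]
    exact mul_nonneg (hg _) (Real.exp_pos _).le

/-- The scales for the lower tails of the exploration. -/
noncomputable def lowerScale (ν ε : ℝ) : ℕ → ℝ
  | 0 => (1 + 2 * ε) / ν
  | j + 1 => ν * lowerScale ν ε j - 1

theorem le_lowerScale_mul {ν ε : ℝ} (hν : 0 < ν) (hεν : 1 + ε ≤ ε * ν) (j : ℕ) :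
    ε * ν ^ j + (1 + ε) ≤ lowerScale ν ε j * ν := by
  induction j with
  | zero =>
    simp only [lowerScale]
    rw [div_mul_cancel₀ _ hν.ne']
    linarith
  | succ j ih =>
    simp only [lowerScale, pow_succ]
    nlinarith

theorem lowerScale_pos {ν ε : ℝ} (hν : 0 < ν) (hε : 0 < ε) (hεν : 1 + ε ≤ ε * ν) (j : ℕ) :
    0 < lowerScale ν ε j := by
  have h := le_lowerScale_mul hν hεν j
  have : 0 < lowerScale ν ε j * ν := by
    have : 0 < ε * ν ^ j := by positivity
    linarith
  exact pos_of_mul_pos_left this hν.le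

/-- The scales satisfy φ_{j+1} + 1 = νφ_j, so θ = 1/φ_{j+1} is carried exactly to νθ/(1 + θ) =
1/φ_j. A cap on the current ball implies the cap on the previous one, so a single indicator
suffices. -/
theorem integral_exp_neg_layer_le (p : unitInterval) (v : V) {κ ν ε : ℝ} (hν : 0 < ν)
    (hε : 0 < ε) (hεν : 1 + ε ≤ ε * ν) (hnp : 1 ≤ Fintype.card V * (p : ℝ))
    (hκ : 2 * (p * κ) ≤ 1) (hνκ : ν ≤ Fintype.card V * p * (1 - 2 * (p * κ))) (j : ℕ) :
    ∫ G, (if ((reached G v j).card : ℝ) ≤ κ then 1 else 0) *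
        Real.exp (-(1 / lowerScale ν ε j * (layer G v j).card)) ∂SimpleGraph.binomialRandom V p ≤
      Real.exp (-(ν / (1 + 2 * ε))) := by
  induction j with
  | zero =>
    refine (integral_mono (g := fun _ => Real.exp (-(ν / (1 + 2 * ε)))) .of_finite .of_finite
      fun G => ?_).trans (by simp)
    simp only [card_layer_zero, lowerScale, one_div_div, Nat.cast_one, mul_one]
    exact mul_le_of_le_one_left (Real.exp_pos _).le (by split_ifs <;> norm_num)
  | succ j ih =>
    have hφ := lowerScale_pos hν hε hεν j
    have hφ' := lowerScale_pos hν hε hεν (j + 1)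
    have hle : ∀ G : SimpleGraph V, ((reached G v j).card : ℝ) ≤ (reached G v (j + 1)).card :=
      fun G => by exact_mod_cast Finset.card_le_card (reached_subset_succ G v j)
    have h := integral_exp_neg_layer_step p v j hnp hκ hνκ (one_div_pos.2 hφ').le
      (g := fun A => if (A.card : ℝ) ≤ κ then 1 else 0) fun A => by
        split_ifs <;> norm_num
    have hc : ν * (1 / lowerScale ν ε (j + 1)) / (1 + 1 / lowerScale ν ε (j + 1)) =
        1 / lowerScale ν ε j := by
      have : lowerScale ν ε (j + 1) + 1 = ν * lowerScale ν ε j := by simp [lowerScale]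
      field_simp
      rw [this]
    rw [hc] at h
    refine le_trans (le_of_eq (integral_congr_ae (.of_forall fun G => ?_))) (h.trans ih)
    simp only
    by_cases hG : ((reached G v (j + 1)).card : ℝ) ≤ κ
    · rw [if_pos hG, if_pos ((hle G).trans hG), one_mul, one_mul, one_mul]
    · rw [if_neg hG, mul_zero]

/-- The layers of the random graph are not much smaller than expected, as long as the balls are
small. -/
theorem measureReal_card_layer_le (p : unitInterval) (v : V) (L : ℕ) {κ κ' ν ε : ℝ} (hν : 0 < ν)
    (hε : 0 < ε) (hε1 : ε ≤ 1) (hεν : 1 + ε ≤ ε * ν) (hnp : 1 ≤ Fintype.card V * (p : ℝ))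
    (hκ : 2 * (p * κ) ≤ 1) (hνκ : ν ≤ Fintype.card V * p * (1 - 2 * (p * κ)))
    (hκ' : 2 * (p * κ') ≤ ε / 4) (hνn : ν ≤ Fintype.card V * p) :
    (SimpleGraph.binomialRandom V p).real
      {G | ((layer G v (L + 1)).card : ℝ) ≤ ε ^ 2 / 2 * ν ^ (L + 1) ∧
        ((reached G v L).card : ℝ) ≤ κ ∧ ((reached G v (L + 1)).card : ℝ) ≤ κ'} ≤
      Real.exp (-(ν * (1 - 3 * ε))) := by
  have hφ := lowerScale_pos hν hε hεν L
  -- The last step is taken under the weaker cap κ', which costs a factor 1 - ε/4 in the growth; ψ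
  -- is the scale adapted to that reduced rate.
  set ψ := (1 - ε / 4) * ν * lowerScale ν ε L - 1 with hψ_def
  have hψ : ε / 2 * ν ^ L ≤ ψ := by
    have h1 := le_lowerScale_mul hν hεν L
    have h2 : 0 < ν ^ L := by positivity
    have h3 := mul_le_mul_of_nonneg_left h1 (show 0 ≤ 1 - ε / 4 by linarith)
    have h4 : ε * (ε * ν ^ L) ≤ 1 * (ε * ν ^ L) := by gcongr
    have h5 : ε * ε ≤ 1 * ε := by gcongr
    nlinarith
  have hψ0 : 0 < ψ := lt_of_lt_of_le (by positivity) hψ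
  have h := integral_exp_neg_layer_step p v L (κ := κ') (ν := (1 - ε / 4) * ν) hnp (by linarith)
    (by
      have h1 : (1 - ε / 4) * ν ≤ (1 - ε / 4) * (Fintype.card V * p) :=
        mul_le_mul_of_nonneg_left hνn (by linarith)
      have h2 : (Fintype.card V * (p : ℝ)) * (1 - ε / 4) ≤
          (Fintype.card V * p) * (1 - 2 * (p * κ')) :=
        mul_le_mul_of_nonneg_left (by linarith) (by linarith)
      linarith) (one_div_pos.2 hψ0).le
    (g := fun A => if (A.card : ℝ) ≤ κ then 1 else 0) fun A => by
      split_ifs <;> norm_num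
  have hc : (1 - ε / 4) * ν * (1 / ψ) / (1 + 1 / ψ) = 1 / lowerScale ν ε L := by
    have : ψ + 1 = (1 - ε / 4) * ν * lowerScale ν ε L := by simp [hψ_def]
    have h1 : (1 - ε / 4) * ν ≠ 0 := (mul_pos (by linarith) hν).ne'
    have h2 : (1 - ε / 4) * ν * (1 / ψ) / (1 + 1 / ψ) = (1 - ε / 4) * ν / (ψ + 1) := by
      field_simp
    rw [h2, this, div_mul_cancel_left₀ h1, one_div]
  rw [hc] at h
  have hbound := h.trans (integral_exp_neg_layer_le p v hν hε hεν hnp hκ hνκ L)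
  -- Since ψ ≥ (ε/2)ν^L, a layer of at most (ε²/2)ν^(L+1) vertices has exponent at most εν. The
  -- total exponent εν - ν/(1 + 2ε) is then at most -ν(1 - 3ε).
  refine (measureReal_le_integral _ (X := fun G => Real.exp (ε * ν) *
    ((if ((reached G v L).card : ℝ) ≤ κ then 1 else 0) *
      (if ((reached G v (L + 1)).card : ℝ) ≤ κ' then 1 else 0) *
      Real.exp (-(1 / ψ * (layer G v (L + 1)).card)))) (fun G => ?_) ?_).trans ?_
  · split_ifs <;> positivity
  · rintro G ⟨h1, h2, h3⟩
    rw [if_pos h2, if_pos h3, one_mul, one_mul, ← Real.exp_add]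
    refine Real.one_le_exp ?_
    have h4 : 1 / ψ * ((layer G v (L + 1)).card : ℝ) ≤ ε * ν := by
      rw [one_div_mul_eq_div, div_le_iff₀ hψ0]
      refine h1.trans ?_
      have := mul_le_mul_of_nonneg_left hψ (show 0 ≤ ε * ν by positivity)
      rw [pow_succ ν]
      linarith
    linarith
  · rw [integral_const_mul]
    refine (mul_le_mul_of_nonneg_left hbound (Real.exp_pos _).le).trans ?_
    rw [← Real.exp_add, Real.exp_le_exp]
    have : ν * (1 - 2 * ε) ≤ ν / (1 + 2 * ε) := by
      rw [le_div_iff₀ (by linarith)]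
      nlinarith [mul_pos hε hε, mul_pos hν (mul_pos hε hε)]
    linarith

/-- If a layer is large, then few vertices are missed one step later. -/
theorem measureReal_missing_le (p : unitInterval) (v : V) (i : ℕ) (b η : ℝ) :
    (SimpleGraph.binomialRandom V p).real
      {G | b ≤ (layer G v i).card ∧
        η * Fintype.card V ≤ Fintype.card V - (reached G v (i + 2)).card} ≤
      Real.exp (Fintype.card V * (2 * Real.exp (-(p * b)) - η)) := by
  classical
  have hp0 : (0 : ℝ) ≤ p := p.2.1
  have hp1 : (p : ℝ) ≤ 1 := p.2.2
  -- With θ = -1, the weight exp(number outside) times exp(-next layer) is the exponential of the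
  -- number of vertices still missed.
  have h := integral_exploration_step v p (-1) i fun A A' =>
    (if b ≤ (A' \ A).card then 1 else 0) * Real.exp ((Fintype.card V - A'.card : ℕ) : ℝ)
  refine (measureReal_le_integral _ (X := fun G => Real.exp (-(η * Fintype.card V)) *
    ((if b ≤ (reached G v (i + 1) \ reached G v i).card then 1 else 0) *
      Real.exp ((Fintype.card V - (reached G v (i + 1)).card : ℕ) : ℝ) *
      Real.exp (-1 * (layer G v (i + 1)).card))) (fun G => ?_) ?_).trans ?_
  · split_ifs <;> positivity
  · rintro G ⟨h1, h2⟩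
    have h1' : b ≤ (reached G v (i + 1) \ reached G v i).card := h1
    rw [if_pos h1', one_mul, ← Real.exp_add, ← Real.exp_add]
    refine Real.one_le_exp ?_
    rw [Nat.cast_sub (Finset.card_le_univ _)]
    have h3 : ((layer G v (i + 1)).card : ℝ) + (reached G v (i + 1)).card =
        (reached G v (i + 2)).card := by exact_mod_cast card_layer_add G v (i + 1)
    linarith
  · rw [integral_const_mul, h]
    have hpt : ∀ G : SimpleGraph V, (if b ≤ (reached G v (i + 1) \ reached G v i).card then 1
        else 0) * Real.exp ((Fintype.card V - (reached G v (i + 1)).card : ℕ) : ℝ) *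
        (Real.exp (-1) - (Real.exp (-1) - 1) * (1 - (p : ℝ)) ^ (layer G v i).card) ^
          (Fintype.card V - (reached G v (i + 1)).card) ≤
        Real.exp (Fintype.card V * (2 * Real.exp (-(p * b)))) := by
      intro G
      set f := (layer G v i).card with hf
      set s := Fintype.card V - (reached G v (i + 1)).card with hs
      by_cases hb : b ≤ (reached G v (i + 1) \ reached G v i).card
      swap
      · rw [if_neg hb, zero_mul, zero_mul]; positivity
      have hb' : b ≤ f := hb
      rw [if_pos hb, one_mul, ← mul_one (s : ℝ), Real.exp_nat_mul, ← mul_pow]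
      have hq0 : 0 ≤ (1 - (p : ℝ)) ^ f := pow_nonneg (by linarith) f
      have hq : (1 - (p : ℝ)) ^ f ≤ Real.exp (-(p * b)) :=
        (one_sub_pow_le hp1 f).trans (Real.exp_le_exp.2 (by nlinarith))
      have he : Real.exp 1 * Real.exp (-1) = 1 := by rw [← Real.exp_add]; simp
      have he3 : Real.exp 1 < 3 := Real.exp_one_lt_three
      have he1 : 1 ≤ Real.exp 1 := Real.one_le_exp zero_le_one
      have hbase : Real.exp 1 * (Real.exp (-1) - (Real.exp (-1) - 1) * (1 - (p : ℝ)) ^ f) =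
          1 + (Real.exp 1 - 1) * (1 - (p : ℝ)) ^ f := by
        linear_combination (1 - (1 - (p : ℝ)) ^ f) * he
      rw [hbase]
      have h1 : 1 + (Real.exp 1 - 1) * (1 - (p : ℝ)) ^ f ≤
          Real.exp (2 * Real.exp (-(p * b))) := by
        refine le_trans ?_ (Real.add_one_le_exp _)
        nlinarith
      refine (pow_le_pow_left₀ (by nlinarith) h1 _).trans ?_
      rw [← Real.exp_nat_mul, Real.exp_le_exp]
      have : (s : ℝ) ≤ Fintype.card V := by exact_mod_cast Nat.sub_le _ _
      gcongr
    refine (mul_le_mul_of_nonneg_left (integral_mono (g := fun _ =>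
      Real.exp (Fintype.card V * (2 * Real.exp (-(p * b))))) .of_finite .of_finite hpt)
      (Real.exp_pos _).le).trans ?_
    rw [integral_const, probReal_univ, one_smul, ← Real.exp_add, Real.exp_le_exp]
    linarith

end Tails

/-! ### The random graph has a threshold radius with high probability. -/

section RandomGraph

open MeasureTheory ProbabilityTheory

/-- Dividing m^L by m, instead of lowering the exponent, covers L = 0, where the set is empty. -/
theorem measureReal_lt_card_reached {V : Type*} [Fintype V] (p : unitInterval) (v : V) (L : ℕ)
    (hp : 1 ≤ Fintype.card V * (p : ℝ)) :
    (SimpleGraph.binomialRandom V p).real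
      {G | 9 * (Fintype.card V * (p : ℝ) + 1) ^ L / (Fintype.card V * (p : ℝ) + 1) <
        (reached G v L).card} ≤ Real.exp (-(2 * (Fintype.card V * (p : ℝ) + 1))) := by
  have hm : 0 < Fintype.card V * (p : ℝ) + 1 := by linarith
  rcases L with _ | L
  · have : {G : SimpleGraph V | 9 * (Fintype.card V * (p : ℝ) + 1) ^ 0 /
        (Fintype.card V * (p : ℝ) + 1) < (reached G v 0).card} = ∅ := by
      refine Set.eq_empty_of_forall_notMem fun G hG => ?_
      have hG : 9 * (Fintype.card V * (p : ℝ) + 1) ^ 0 / (Fintype.card V * (p : ℝ) + 1) <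
        ((reached G v 0).card : ℝ) := hG
      rw [reached, Finset.card_empty, Nat.cast_zero] at hG
      exact absurd hG (not_lt.2 (by positivity))
    rw [this, measureReal_empty]
    positivity
  · refine (measureReal_mono fun G hG => ?_).trans (measureReal_le_card_reached p v L hp)
    have hG : 9 * (Fintype.card V * (p : ℝ) + 1) ^ (L + 1) / (Fintype.card V * (p : ℝ) + 1) <
        ((reached G v (L + 1)).card : ℝ) := hG
    rw [pow_succ, ← mul_assoc, mul_div_cancel_right₀ _ hm.ne'] at hG
    exact hG.le

theorem add_two_pow_le {d : ℝ} (hd : 0 < d) {j : ℕ} (hj : 2 * (j : ℝ) ≤ d) :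
    (d + 2) ^ j ≤ 3 * d ^ j := by
  have h1 : d + 2 ≤ d * Real.exp (2 / d) := by
    have := mul_le_mul_of_nonneg_left (Real.add_one_le_exp (2 / d)) hd.le
    rwa [mul_add, mul_div_cancel₀ _ hd.ne', mul_one, add_comm] at this
  calc (d + 2) ^ j ≤ (d * Real.exp (2 / d)) ^ j := pow_le_pow_left₀ (by linarith) h1 j
    _ = d ^ j * Real.exp (j * (2 / d)) := by rw [mul_pow, ← Real.exp_nat_mul]
    _ ≤ d ^ j * Real.exp 1 := by
      gcongr
      rw [← mul_div_assoc, div_le_one hd]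
      linarith
    _ ≤ 3 * d ^ j := by
      rw [mul_comm]
      gcongr
      exact Real.exp_one_lt_three.le

theorem half_pow_le_sub_one_pow {d : ℝ} (hd : 1 ≤ d) {j : ℕ} (hj : 2 * (j : ℝ) ≤ d) :
    d ^ j / 2 ≤ (d - 1) ^ j := by
  have hd0 : 0 < d := by linarith
  have h1 : d - 1 = d * (1 + -(1 / d)) := by field_simp; ring
  have h2 : 1 / d ≤ 1 := by rw [div_le_one hd0]; exact hd
  have h3 := one_add_mul_le_pow (a := -(1 / d)) (by linarith) j
  have h4 : (j : ℝ) * (1 / d) ≤ 1 / 2 := by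
    rw [mul_one_div, div_le_iff₀ hd0]; linarith
  rw [h1, mul_pow, div_eq_mul_one_div]
  exact mul_le_mul_of_nonneg_left (by linarith) (by positivity)

/-- The parameters of the exploration of a random graph with `n` vertices, expected degree `d` and
edge probability `p`, up to radius `L + 2`. -/
structure ExplorationBounds (n p d ε η : ℝ) (L : ℕ) : Prop where
  le_mul : d ≤ n * p
  small_ball : 2 * (p * (9 * (n * p + 1) ^ L / (n * p + 1))) ≤ 1 / d
  medium_ball : 2 * (p * (9 * (n * p + 1) ^ L)) ≤ ε / 4
  large_ball : 9 * (n * p + 1) ^ (L + 1) ≤ η * n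
  missing : 2 * Real.exp (-(p * (ε ^ 2 / 2 * (d - 1) ^ (L + 1)))) ≤ η / 2

/-- Everything follows from d^(L+1)/n ≤ 1/M and d^(L+2)/n ≥ M. Two caps are needed: the small balls
cost only a relative 1/d per step, so growth by d - 1 over L steps loses no more than a constant
factor overall. The constant loss at the medium ball is affordable because it occurs once. -/
theorem explorationBounds {n p d ε η M : ℝ} {L : ℕ} (hn2 : 2 ≤ n) (hd : 2 ≤ d)
    (hdn : d ≤ n - 1) (hp : p = d / (n - 1)) (hε : 0 < ε)
    (hL : 2 * ((L + 1 : ℕ) : ℝ) ≤ d) (hM₁ : 108 ≤ M) (hM₂ : 432 ≤ M * ε) (hM₃ : 27 ≤ M * η)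
    (hM₄ : 16 ≤ M * (ε ^ 2 * η)) (hlow : M * d ^ (L + 1) ≤ n) (hhigh : M * n ≤ d ^ (L + 2)) :
    ExplorationBounds n p d ε η L := by
  have hd0 : 0 < d := by linarith
  have hn0 : 0 < n := by linarith
  have hn1 : 0 < n - 1 := by linarith
  have hp_le : p ≤ 2 * d / n := by
    rw [hp, div_le_div_iff₀ hn1 (by linarith)]
    nlinarith
  have hp_ge : d / n ≤ p := by
    rw [hp]
    gcongr
    linarith
  have hp0 : 0 ≤ p := (div_nonneg hd0.le hn0.le).trans hp_ge
  have hnp_ge : d ≤ n * p := by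
    have := (div_le_iff₀ (by linarith : 0 < n)).1 hp_ge
    linarith
  have hnp_eq : n * p = d + p := by
    rw [hp]
    field_simp
    ring
  have hp1 : p ≤ 1 := by
    rw [hp, div_le_one hn1]
    exact hdn
  set m := n * p + 1 with hm_def
  have hm_le : m ≤ d + 2 := by linarith
  have hm_ge : d ≤ m := by linarith
  have hm0 : 0 < m := by linarith
  have hpow : ∀ j ≤ L + 1, m ^ j ≤ 3 * d ^ j := by
    intro j hj
    refine (pow_le_pow_left₀ hm0.le hm_le j).trans (add_two_pow_le hd0 (le_trans ?_ hL))
    have : (j : ℝ) ≤ ((L + 1 : ℕ) : ℝ) := by exact_mod_cast hj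
    linarith
  have hdL : 0 < d ^ L := by positivity
  have hM0 : 0 < M := by linarith
  have hratio : M * (d ^ (L + 1) / n) ≤ 1 := by
    rw [← mul_div_assoc, div_le_one hn0]
    exact hlow
  have hratio0 : 0 < d ^ (L + 1) / n := by positivity
  have hκ : 2 * (p * (9 * m ^ L / m)) ≤ 1 / d := by
    have h1 : 9 * m ^ L / m ≤ 9 * (3 * d ^ L) / d := by
      gcongr
      exact hpow L (by omega)
    calc 2 * (p * (9 * m ^ L / m)) ≤ 2 * (2 * d / n * (9 * (3 * d ^ L) / d)) := by gcongr
      _ = 108 * (d ^ (L + 1) / n) / d := by field_simp; ring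
      _ ≤ 1 / d := by
        gcongr
        nlinarith
  have hκ' : 2 * (p * (9 * m ^ L)) ≤ ε / 4 := by
    have h1 : 9 * m ^ L ≤ 9 * (3 * d ^ L) := by
      gcongr
      exact hpow L (by omega)
    calc 2 * (p * (9 * m ^ L)) ≤ 2 * (2 * d / n * (9 * (3 * d ^ L))) := by gcongr
      _ = 108 * (d ^ (L + 1) / n) := by field_simp; ring
      _ ≤ ε / 4 := by nlinarith
  set b := ε ^ 2 / 2 * (d - 1) ^ (L + 1) with hb_def
  have hpb : 2 * Real.exp (-(p * b)) ≤ η / 2 := by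
    have h1 : ε ^ 2 / 4 * M ≤ p * b := by
      have h2 := half_pow_le_sub_one_pow (by linarith : 1 ≤ d) hL
      calc ε ^ 2 / 4 * M ≤ ε ^ 2 / 4 * (d ^ (L + 2) / n) := by
            gcongr
            rw [le_div_iff₀ hn0]
            exact hhigh
        _ = d / n * (ε ^ 2 / 2 * (d ^ (L + 1) / 2)) := by rw [pow_succ d (L + 1)]; ring
        _ ≤ p * b := by rw [hb_def]; gcongr
    have h3 : 0 < ε ^ 2 / 4 * M := by positivity
    have h4 := exp_neg_le_inv (h3.le.trans h1)
    have h5 : 1 / (1 + p * b) ≤ 1 / (ε ^ 2 / 4 * M) :=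
      one_div_le_one_div_of_le h3 (by linarith)
    have h6 : 1 / (ε ^ 2 / 4 * M) ≤ η / 4 := by
      rw [div_le_iff₀ h3]
      linarith
    linarith
  refine ⟨hnp_ge, hκ, hκ', ?_, hpb⟩
  have h7 : n * (27 * (d ^ (L + 1) / n)) ≤ n * η := by
    gcongr
    nlinarith
  have h8 : n * (27 * (d ^ (L + 1) / n)) = 27 * d ^ (L + 1) := by field_simp
  linarith [hpow (L + 1) le_rfl]

/-- The balls of radius `L + 1` around a vertex are likely to be small, and those of radius
`L + 2` to be almost everything. -/
theorem measureReal_not_threshold_le {V : Type*} [Fintype V] (p : unitInterval) (v : V)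
    {d ε η : ℝ} {L : ℕ} (hd : 2 ≤ d) (hε : 0 < ε) (hε1 : ε ≤ 1) (hεd : 1 + ε ≤ ε * (d - 1))
    (hb : ExplorationBounds (Fintype.card V) p d ε η L) :
    (SimpleGraph.binomialRandom V p).real
      {G | ¬ (((iterNbhd G (L + 1) v).ncard : ℝ) ≤ η * Fintype.card V ∧
        (Fintype.card V : ℝ) - (iterNbhd G (L + 2) v).ncard ≤ η * Fintype.card V)} ≤
      3 * Real.exp (-(2 * d)) + Real.exp (-((d - 1) * (1 - 3 * ε))) +
        Real.exp (-(Fintype.card V * η / 2)) := by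
  obtain ⟨hnp_ge, hκ, hκ', hlarge, hpb⟩ := hb
  set n : ℝ := (Fintype.card V : ℝ) with hn_def
  have hn0 : 0 ≤ n := Nat.cast_nonneg _
  set m := n * (p : ℝ) + 1 with hm_def
  set b := ε ^ 2 / 2 * (d - 1) ^ (L + 1) with hb_def
  have hd0 : 0 < d := by linarith
  have hinv : 1 / d ≤ 1 := by rw [div_le_one hd0]; linarith
  have hνκ : d - 1 ≤ n * p * (1 - 2 * (p * (9 * m ^ L / m))) := by
    have h1 : d * (1 - 1 / d) = d - 1 := by field_simp
    rw [← h1]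
    exact mul_le_mul hnp_ge (by linarith) (by linarith) (by linarith)
  have hnp1 : 1 ≤ n * (p : ℝ) := by linarith
  have hexp : Real.exp (-(2 * m)) ≤ Real.exp (-(2 * d)) := Real.exp_le_exp.2 (by linarith)
  have E₁ := (measureReal_lt_card_reached p v L hnp1).trans hexp
  have E₂ := (measureReal_le_card_reached p v L hnp1).trans hexp
  have E₃ := (measureReal_le_card_reached p v (L + 1) hnp1).trans hexp
  have E₄ := measureReal_card_layer_le p v L (by linarith : 0 < d - 1) hε hε1 hεd hnp1
    (hκ.trans hinv) hνκ hκ' (by linarith)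
  have E₅ := (measureReal_missing_le p v (L + 1) b η).trans
    (Real.exp_le_exp.2 (show n * (2 * Real.exp (-(p * b)) - η) ≤ -(n * η / 2) by
      have := mul_le_mul_of_nonneg_left hpb hn0
      linarith))
  -- Five bad events: one of three balls too large, layer L + 1 too small although the balls are
  -- capped, or too many vertices missed although that layer is large.
  have hsub : {G : SimpleGraph V | ¬ (((iterNbhd G (L + 1) v).ncard : ℝ) ≤ η * n ∧
      n - (iterNbhd G (L + 2) v).ncard ≤ η * n)} ⊆
      (({G | 9 * m ^ L / m < (reached G v L).card} ∪ {G | 9 * m ^ L ≤ (reached G v (L + 1)).card}) ∪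
        {G | 9 * m ^ (L + 1) ≤ (reached G v (L + 1 + 1)).card}) ∪
      {G | ((layer G v (L + 1)).card : ℝ) ≤ ε ^ 2 / 2 * (d - 1) ^ (L + 1) ∧
        ((reached G v L).card : ℝ) ≤ 9 * m ^ L / m ∧
        ((reached G v (L + 1)).card : ℝ) ≤ 9 * m ^ L} ∪
      {G | b ≤ (layer G v (L + 1)).card ∧ η * n ≤ n - (reached G v (L + 1 + 2)).card} := by
    intro G hG
    by_contra hcon
    simp only [Set.mem_union, Set.mem_ofPred_eq, not_or, not_lt, not_le, not_and] at hcon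
    obtain ⟨⟨⟨⟨h1, h2⟩, h3⟩, h4⟩, h5⟩ := hcon
    refine hG ⟨?_, ?_⟩
    · rw [← card_reached_succ]
      exact h3.le.trans hlarge
    · rw [← card_reached_succ]
      refine (h5 ?_).le
      by_contra h6
      exact absurd (h4 (not_le.1 h6).le h1) (not_lt.2 h2.le)
  refine (measureReal_mono hsub).trans ?_
  refine (measureReal_union_le _ _).trans (add_le_add ?_ E₅)
  refine (measureReal_union_le _ _).trans (add_le_add ?_ E₄)
  refine (measureReal_union_le _ _).trans ?_
  have := measureReal_union_le (μ := SimpleGraph.binomialRandom V p)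
    {G | 9 * m ^ L / m < (reached G v L).card} {G | 9 * m ^ L ≤ (reached G v (L + 1)).card}
  linarith

theorem hasThreshold_of_forall {n : ℕ} {G : SimpleGraph (Fin n)} {δ : ℝ} {ρ : ℕ}
    (h : ∀ v, ((iterNbhd G ρ v).ncard : ℝ) ≤ δ / 2 * n ∧
      (n : ℝ) - (iterNbhd G (ρ + 1) v).ncard ≤ δ / 2 * n) :
    HasThreshold G (min n (⌊δ * n⌋₊ / 2)) := by
  have key : ∀ c : ℕ, (c : ℝ) ≤ δ / 2 * n → c ≤ ⌊δ * n⌋₊ / 2 := by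
    intro c hc
    rw [Nat.le_div_iff_mul_le two_pos]
    refine Nat.le_floor ?_
    push_cast
    linarith
  have hle : ∀ i v, (iterNbhd G i v).ncard ≤ n := fun i v =>
    (Set.ncard_le_card _).trans_eq (by simp)
  refine ⟨ρ, fun v => ⟨le_min (hle _ _) (key _ (h v).1), ?_⟩⟩
  have h1 : n - (iterNbhd G (ρ + 1) v).ncard ≤ min n (⌊δ * n⌋₊ / 2) := by
    refine le_min (Nat.sub_le _ _) (key _ ?_)
    rw [Nat.cast_sub (hle _ _)]
    exact (h v).2
  rw [Fintype.card_fin]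
  omega

/-- L + 1 is the largest exponent with d^(L+1) ≤ n, positive since d < n; the gap hypothesis at L +
1 and at L + 2 gives the factors M. -/
theorem exists_pow_gap {n d M : ℝ} (hd : 1 < d) (hdn : d ≤ n - 1) (hM : 1 ≤ M)
    (hgap : ∀ i : ℕ, 1 ≤ i → ¬ (n ≤ M * d ^ i ∧ d ^ i ≤ M * n)) :
    ∃ L : ℕ, M * d ^ (L + 1) ≤ n ∧ M * n ≤ d ^ (L + 2) ∧ d ^ (L + 1) ≤ n := by
  have hn : 1 ≤ n := by linarith
  obtain ⟨i, h1, h2⟩ := exists_nat_pow_near hn hd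
  rcases i with _ | L
  · rw [zero_add, pow_one] at h2
    linarith
  have hMn : n ≤ M * n := le_mul_of_one_le_left (by linarith) hM
  refine ⟨L, ?_, ?_, h1⟩
  · by_contra h
    exact hgap (L + 1) (by omega) ⟨(not_le.1 h).le, h1.trans hMn⟩
  · by_contra h
    have h3 : d ^ (L + 1 + 1) ≤ M * d ^ (L + 1 + 1) := le_mul_of_one_le_left (by positivity) hM
    exact hgap (L + 2) (by omega) ⟨h2.le.trans h3, (not_le.1 h).le⟩

/-- The number of rounds is at most log n / log d, hence small compared with d. This is what keeps
(d + 2)^j and (d - 1)^j within constant factors of d^j. -/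
theorem two_mul_le_of_pow_le {n d : ℝ} {i : ℕ} (hd : Real.exp 2 ≤ d) (h : d ^ i ≤ n)
    (hn : Real.log n ≤ d) : 2 * (i : ℝ) ≤ d := by
  have hd0 : 0 < d := (Real.exp_pos 2).trans_le hd
  have h1 : (i : ℝ) * Real.log d ≤ Real.log n := by
    rw [← Real.log_pow]
    exact Real.log_le_log (by positivity) h
  have h2 : 2 ≤ Real.log d := (Real.le_log_iff_exp_le hd0).2 hd
  have : (i : ℝ) * 2 ≤ i * Real.log d := by gcongr
  linarith

/-- An upper bound for the probability that the traversal algorithm rejects. -/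
noncomputable def failureBound (C ε η : ℝ) (n : ℕ) : ℝ :=
  n * (3 * Real.exp (-(2 * (C * Real.log n))) +
    Real.exp (-((C * Real.log n - 1) * (1 - 3 * ε))) + Real.exp (-(n * η / 2)))

theorem tendsto_failureBound {C ε η : ℝ} (hC : 1 < C) (hε : 1 < C * (1 - 3 * ε)) (hη : 0 < η) :
    Tendsto (failureBound C ε η) atTop (𝓝 0) := by
  have hlog : Tendsto (fun n : ℕ => Real.log n) atTop atTop :=
    Real.tendsto_log_atTop.comp tendsto_natCast_atTop_atTop
  have hexp : ∀ γ : ℝ, 0 < γ → Tendsto (fun n : ℕ => Real.exp (-(γ * Real.log n))) atTop (𝓝 0) :=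
    fun γ hγ => Real.tendsto_exp_neg_atTop_nhds_zero.comp (hlog.const_mul_atTop hγ)
  have h1 := (hexp (2 * C - 1) (by linarith)).const_mul 3
  have h2 := (hexp (C * (1 - 3 * ε) - 1) (by linarith)).const_mul (Real.exp (1 - 3 * ε))
  have h3 : Tendsto (fun n : ℕ => 2 / η * ((n * η / 2) ^ 1 * Real.exp (-(n * η / 2)))) atTop
      (𝓝 (2 / η * 0)) := by
    refine Tendsto.const_mul _ ((Real.tendsto_pow_mul_exp_neg_atTop_nhds_zero 1).comp
      (g := fun x : ℝ => x ^ 1 * Real.exp (-x)) (f := fun n : ℕ => (n : ℝ) * η / 2) ?_)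
    exact (tendsto_natCast_atTop_atTop.atTop_mul_const hη).atTop_div_const two_pos
  have h := (h1.add h2).add h3
  simp only [mul_zero, add_zero] at h
  refine h.congr' ?_
  filter_upwards [eventually_gt_atTop 0] with n hn
  have hn0 : (0 : ℝ) < n := by exact_mod_cast hn
  have e : ∀ x : ℝ, n * Real.exp (-x) = Real.exp (Real.log n - x) := by
    intro x
    rw [sub_eq_add_neg, Real.exp_add, Real.exp_log hn0]
  have e₁ : n * (3 * Real.exp (-(2 * (C * Real.log n)))) =
      3 * Real.exp (-((2 * C - 1) * Real.log n)) := by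
    rw [mul_left_comm, e]
    ring_nf
  have e₂ : n * Real.exp (-((C * Real.log n - 1) * (1 - 3 * ε))) =
      Real.exp (1 - 3 * ε) * Real.exp (-((C * (1 - 3 * ε) - 1) * Real.log n)) := by
    rw [e, ← Real.exp_add]
    ring_nf
  have e₃ : n * Real.exp (-(n * η / 2)) =
      2 / η * ((n * η / 2) ^ 1 * Real.exp (-(n * η / 2))) := by
    rw [pow_one, ← mul_assoc]
    congr 1
    field_simp
  rw [failureBound, mul_add, mul_add, e₁, e₂, e₃]

instance (n : ℕ) (d : ℝ) : IsProbabilityMeasure (randomGraph n d) := by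
  unfold randomGraph; infer_instance

theorem measureReal_not_hasThreshold_le {n : ℕ} {d C ε δ M : ℝ} (hn : 2 ≤ n)
    (hd : Real.exp 2 ≤ d) (hdn : d ≤ n - 1) (hC : 1 < C) (hCd : C * Real.log n ≤ d) (hε : 0 < ε)
    (hε1 : 3 * ε ≤ 1) (hεd : 1 + ε ≤ ε * (d - 1)) (hM₁ : 108 ≤ M) (hM₂ : 432 ≤ M * ε)
    (hM₃ : 27 ≤ M * (δ / 2)) (hM₄ : 16 ≤ M * (ε ^ 2 * (δ / 2)))
    (hgap : ∀ i : ℕ, 1 ≤ i → ¬ ((n : ℝ) ≤ M * d ^ i ∧ d ^ i ≤ M * (n : ℝ))) :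
    (randomGraph n d).real {G | ¬ HasThreshold G (min n (⌊δ * n⌋₊ / 2))} ≤
      failureBound C ε (δ / 2) n := by
  have hn2 : (2 : ℝ) ≤ n := by exact_mod_cast hn
  have hd2 : 2 ≤ d := by linarith [Real.add_one_le_exp (2 : ℝ)]
  have hlog : 0 ≤ Real.log n := Real.log_nonneg (by linarith)
  obtain ⟨L, hlow, hhigh, hpow⟩ := exists_pow_gap (by linarith : 1 < d) hdn (by linarith) hgap
  have hL := two_mul_le_of_pow_le hd hpow (by nlinarith)
  set p : unitInterval := Set.projIcc (0 : ℝ) 1 zero_le_one (d / ((n : ℝ) - 1)) with hp_def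
  have hp : (p : ℝ) = d / ((n : ℝ) - 1) := by
    have : d / ((n : ℝ) - 1) ∈ Set.Icc (0 : ℝ) 1 :=
      ⟨div_nonneg (by linarith) (by linarith), (div_le_one (by linarith)).2 hdn⟩
    rw [hp_def, Set.projIcc_of_mem zero_le_one this]
  have hbounds := explorationBounds hn2 hd2 hdn hp hε hL hM₁ hM₂ hM₃ hM₄
    hlow hhigh
  have hsub : {G : SimpleGraph (Fin n) | ¬ HasThreshold G (min n (⌊δ * n⌋₊ / 2))} ⊆
      ⋃ v ∈ (Finset.univ : Finset (Fin n)),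
        {G | ¬ (((iterNbhd G (L + 1) v).ncard : ℝ) ≤ δ / 2 * n ∧
          (n : ℝ) - (iterNbhd G (L + 2) v).ncard ≤ δ / 2 * n)} := by
    intro G hG
    by_contra hcon
    simp only [Finset.mem_univ, Set.iUnion_true, Set.mem_iUnion, Set.mem_ofPred_eq, not_exists,
      not_not] at hcon
    exact hG (hasThreshold_of_forall hcon)
  have hone : ∀ v : Fin n, (SimpleGraph.binomialRandom (Fin n) p).real
      {G | ¬ (((iterNbhd G (L + 1) v).ncard : ℝ) ≤ δ / 2 * n ∧
        (n : ℝ) - (iterNbhd G (L + 2) v).ncard ≤ δ / 2 * n)} ≤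
      3 * Real.exp (-(2 * (C * Real.log n))) +
        Real.exp (-((C * Real.log n - 1) * (1 - 3 * ε))) + Real.exp (-(n * (δ / 2) / 2)) := by
    intro v
    have h := measureReal_not_threshold_le p v hd2 hε (by linarith) hεd
      (by rw [Fintype.card_fin]; exact hbounds)
    simp only [Fintype.card_fin] at h
    refine h.trans ?_
    have h1 : (C * Real.log n - 1) * (1 - 3 * ε) ≤ (d - 1) * (1 - 3 * ε) :=
      mul_le_mul_of_nonneg_right (by linarith) (by linarith)
    gcongr
  change (SimpleGraph.binomialRandom (Fin n) p).real _ ≤ _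
  calc (SimpleGraph.binomialRandom (Fin n) p).real {G | ¬ HasThreshold G (min n (⌊δ * n⌋₊ / 2))}
      ≤ (SimpleGraph.binomialRandom (Fin n) p).real (⋃ v ∈ (Finset.univ : Finset (Fin n)),
        {G | ¬ (((iterNbhd G (L + 1) v).ncard : ℝ) ≤ δ / 2 * n ∧
          (n : ℝ) - (iterNbhd G (L + 2) v).ncard ≤ δ / 2 * n)}) :=
      measureReal_mono hsub (measure_ne_top _ _)
    _ ≤ ∑ v : Fin n, (SimpleGraph.binomialRandom (Fin n) p).real
        {G | ¬ (((iterNbhd G (L + 1) v).ncard : ℝ) ≤ δ / 2 * n ∧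
          (n : ℝ) - (iterNbhd G (L + 2) v).ncard ≤ δ / 2 * n)} :=
      measureReal_biUnion_finset_le _ _
    _ ≤ failureBound C ε (δ / 2) n := (Finset.sum_le_sum fun v _ => hone v).trans_eq (by
      rw [Finset.sum_const, Finset.card_univ, Fintype.card_fin, nsmul_eq_mul, failureBound])

theorem tendsto_hasThreshold {d : ℕ → ℝ} (hdn : ∀ᶠ n : ℕ in atTop, d n ≤ (n : ℝ) - 1)
    {C : ℝ} (hC : 1 < C) (hCd : ∀ᶠ n : ℕ in atTop, C * Real.log n ≤ d n)
    (hgap : ∀ M : ℝ, 0 < M → ∀ᶠ n : ℕ in atTop, ∀ i : ℕ, 1 ≤ i →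
      ¬ ((n : ℝ) ≤ M * d n ^ i ∧ d n ^ i ≤ M * (n : ℝ))) {δ : ℝ} (hδ : 0 < δ) :
    Tendsto (fun n : ℕ => (randomGraph n (d n)).real
      {G | ¬ HasThreshold G (min n (⌊δ * n⌋₊ / 2))}) atTop (𝓝 0) := by
  -- With this ε, C(1 - 3ε) = (C + 1)/2 > 1, so the union bound over n vertices still tends to zero.
  set ε := (C - 1) / (6 * C) with hε_def
  have hε : 0 < ε := div_pos (by linarith) (by linarith)
  have hεC : C * (3 * ε) = (C - 1) / 2 := by rw [hε_def]; field_simp; ring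
  have hε1 : 3 * ε ≤ 1 := by
    by_contra h
    nlinarith
  -- One summand for each lower bound on M that `explorationBounds` requires, with η = δ/2.
  set M := 108 + 432 / ε + 27 / (δ / 2) + 16 / (ε ^ 2 * (δ / 2)) with hM_def
  have hM : ∀ x y : ℝ, 0 < x → y / x ≤ M → y ≤ M * x := fun x y hx h =>
    (div_le_iff₀ hx).1 h
  have p1 : 0 < 432 / ε := by positivity
  have p2 : 0 < 27 / (δ / 2) := by positivity
  have p3 : 0 < 16 / (ε ^ 2 * (δ / 2)) := by positivity
  have hlog : Tendsto (fun n : ℕ => Real.log n) atTop atTop :=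
    Real.tendsto_log_atTop.comp tendsto_natCast_atTop_atTop
  refine squeeze_zero' (.of_forall fun n => measureReal_nonneg) ?_
    (tendsto_failureBound (ε := ε) (η := δ / 2) hC (by linarith) (by linarith))
  filter_upwards [hdn, hCd, hgap M (by linarith), eventually_ge_atTop 2,
    hlog.eventually_ge_atTop (Real.exp 2), hlog.eventually_ge_atTop ((1 + ε) / ε + 1)]
    with n h1 h2 h3 h4 h5 h6
  have hdl : Real.log n ≤ d n := by
    have : 0 ≤ Real.log n := (Real.exp_pos 2).le.trans h5
    nlinarith
  refine measureReal_not_hasThreshold_le h4 (h5.trans hdl) h1 hC h2 hε hε1 ?_ (by linarith)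
    (hM _ _ hε (by linarith)) (hM _ _ (by linarith) (by linarith))
    (hM _ _ (by positivity) (by linarith)) h3
  have : (1 + ε) / ε ≤ d n - 1 := by linarith
  rw [div_le_iff₀ hε] at this
  linarith

end RandomGraph

end FacilityGame

/-! ### Assembly of the four properties. -/

theorem mainTheorem5 :
    ∃ (A : FacilityGame.Prog) (T : ℕ) (c₂ : ℝ), 0 < c₂ ∧
      -- running time `O(n (m + n))` on every input
      (∀ (n : ℕ) (G : SimpleGraph (Fin n)) (k z : ℕ),
        A.HaltsWithin (FacilityGame.inputState G k z)
          (T * (n * (G.edgeSet.ncard + n) + 1))) ∧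
      -- acceptance is a certificate of balancedness, for every graph
      (∀ (n : ℕ) (G : SimpleGraph (Fin n)) (k : ℕ) (δ : ℝ), 0 ≤ δ →
        A.Accepts (FacilityGame.inputState G k ⌊δ * n⌋₊) →
        FacilityGame.IsBalanced G k (δ * n)) ∧
      -- every graph that satisfies the two conditions on the neighborhood sizes is accepted
      (∀ (n : ℕ) (G : SimpleGraph (Fin n)) (k : ℕ) (δ : ℝ), 0 ≤ δ →
        FacilityGame.TraversalConditions G k (δ * n) →
        A.Accepts (FacilityGame.inputState G k ⌊δ * n⌋₊)) ∧
      -- acceptance with high probability on `G_{n,d}`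
      (∀ d : ℕ → ℝ,
        (∀ᶠ n : ℕ in atTop, d n ≤ (n : ℝ) - 1) →
        (∃ C : ℝ, 1 < C ∧ ∀ᶠ n : ℕ in atTop, C * Real.log n ≤ d n) →
        (∀ M : ℝ, 0 < M → ∀ᶠ n : ℕ in atTop, ∀ i : ℕ, 1 ≤ i →
          ¬ ((n : ℝ) ≤ M * d n ^ i ∧ d n ^ i ≤ M * (n : ℝ))) →
        ∀ (c₁ : ℝ), 0 < c₁ → ∀ k : ℕ → ℕ, (∀ᶠ n : ℕ in atTop, |(k n : ℝ) - c₁ * d n| < 1) →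
        ∀ δ : ℝ, c₁ * c₂ ≤ δ →
          Tendsto (fun n : ℕ => FacilityGame.randomGraph n (d n)
              {G | A.Accepts (FacilityGame.inputState G (k n) ⌊δ * n⌋₊)})
            atTop (𝓝 1)) := by
  open FacilityGame MeasureTheory in
  -- The constant c₂ = 1 is a convenient choice: on the random graph, c₁c₂ ≤ δ serves to make δ
  -- positive.
  refine ⟨traversalProg, 1000, 1, one_pos, fun n G k z => traversalProg_haltsWithin G k z, ?_, ?_,
    ?_⟩
  · intro n G k δ hδ h
    have hz : 0 ≤ δ * n := by positivity
    rcases (traversalProg_accepts_iff G k _).1 h with hk | h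
    · exact isBalanced_of_le_one G hk hz
    · refine h.isBalanced k ?_
      have h1 : 2 * min n (⌊δ * n⌋₊ / 2) ≤ ⌊δ * n⌋₊ := by omega
      calc 2 * ((min n (⌊δ * n⌋₊ / 2) : ℕ) : ℝ) ≤ (⌊δ * n⌋₊ : ℝ) := by exact_mod_cast h1
        _ ≤ δ * n := Nat.floor_le hz
  · intro n G k δ _ h
    rw [traversalProg_accepts_iff]
    rcases le_or_gt k 1 with hk | hk
    · exact Or.inl hk
    · simpa using Or.inr (h.hasThreshold hk)
  · rintro d hdn ⟨C, hC, hCd⟩ hgap c₁ hc₁ k _ δ hδ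
    have hlim := tendsto_hasThreshold hdn hC hCd hgap (δ := δ) (by linarith)
    have hreal : Tendsto (fun n : ℕ => (randomGraph n (d n)).real
        {G | traversalProg.Accepts (inputState G (k n) ⌊δ * n⌋₊)}) atTop (𝓝 1) := by
      -- A rejected graph has no threshold radius, so the acceptance probability lies between 1
      -- minus the failure probability and 1.
      refine tendsto_of_tendsto_of_tendsto_of_le_of_le (by simpa using hlim.const_sub 1)
        tendsto_const_nhds (fun n => ?_) fun n => measureReal_le_one
      have h1 := measureReal_compl (μ := randomGraph n (d n))
        (s := {G | traversalProg.Accepts (inputState G (k n) ⌊δ * n⌋₊)}) .of_discrete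
      have h2 : (randomGraph n (d n)).real
          {G | traversalProg.Accepts (inputState G (k n) ⌊δ * n⌋₊)}ᶜ ≤
          (randomGraph n (d n)).real {G | ¬ HasThreshold G (min n (⌊δ * n⌋₊ / 2))} :=
        measureReal_mono fun G hG hth => hG ((traversalProg_accepts_iff G (k n) _).2 (Or.inr hth))
      rw [probReal_univ] at h1
      simp only
      linarith
    have := ENNReal.tendsto_ofReal hreal
    rw [ENNReal.ofReal_one] at this
    exact this.congr fun n => ofReal_measureReal
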